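/- **Linear policies.** Call $f:\mathbf R^N\to\mathbf R\cup\{+\infty\}$ a *quadratic form with homogeneous equality constraints* if $f(z)=\tfrac12 z^TPz$ when $Fz=0$ and $f(z)=+\infty$ otherwise, for some symmetric $P$ and some matrix $F$ (possibly with no rows). Consider a state $x_t\in\mathbf R^n$, a control $u_t\in\mathbf R^m$ and a mode $s_t\in\{1,\dots,K\}$. The disturbances $w_t\in\mathcal W_t$ are independent of each other and of the modes; the modes form a Markov chain with $\mathbf P(s_{t+1}=i\mid s_t=j)=\Pi_{t,ij}$, unaffected by states and controls. The dynamics are linear, $$x_{t+1}=A_t^{s_t}(w_t)x_t+B_t^{s_t}(w_t)u_t,$$ and for every $t$, $s$ and $w\in\mathcal W_t$ the stage cost $g_t^s(\cdot,\cdot,w)$ is a jointly convex quadratic form in $(x,u)$ with homogeneous equality constraints $F_t^sx+H_t^su=0$ that do not depend on $w$ (the matrices $A_t^s(w)$, $B_t^s(w)$ and that of the quadratic form may be random, with measurable entries). Policies are Borel measurable functions $\phi_t^s:\mathbf R^n\to\mathbf R^m$, used as $u_t=\phi_t^{s_t}(x_t)$. (a) *Finite horizon.* Let $T\ge 0$ and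 let each final cost $g_T^s$ be a convex quadratic form with homogeneous equality constraints. For $0\le t\le T$ let $$V_t^s(x)=\inf_{\phi}\ \mathbf E\Big[\sum_{\tau=t}^{T-1}g_\tau^{s_\tau}(x_\tau,\phi_\tau^{s_\tau}(x_\tau),w_\tau)+g_T^{s_T}(x_T)\Big],\qquad x_t=x,\ s_t=s,$$ be the cost-to-go functions, and for $t<T$ let $$Q_t^s(x,u)=\mathbf E_{w_t}\mathbf E_{s'}\big[g_t^s(x,u,w_t)+V_{t+1}^{s'}(A_t^s(w_t)x+B_t^s(w_t)u)\big],$$ where $s'=i$ with probability $\Pi_{t,is}$. Then every $V_t^s$ is a quadratic form with homogeneous equality constraints, and there are matrices $K_t^s\in\mathbf R^{m\times n}$ such that the linear policies $\phi_t^s(x)=K_t^sx$ are optimal: they attain $V_t^s(x)$ for all $t\le T$, $s$, $x$, and $K_t^sx$ minimizes $Q_t^s(x,\cdot)$ for all $t<T$, $s$, $x$. (b) *Infinite horizon.* Let the data $(\mathcal W,\text{law of }w,A,B,g,\Pi)$ be time-invariant and let $\gamma\in(0,1]$. For a time-invariant policy $\phi$ let $$J_\phi^s(x)=\limsup_{N\to\infty}\mathbf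 E\Big[\sum_{t=0}^{N}\gamma^tg^{s_t}(x_t,\phi^{s_t}(x_t),w_t)\Big],\qquad x_0=x,\ s_0=s,$$ let $V^s(x)=\inf_\phi J_\phi^s(x)$ over time-invariant policies, and let $Q^s(x,u)=\mathbf E_{w}\mathbf E_{s'}[g^s(x,u,w)+\gamma V^{s'}(A^s(w)x+B^s(w)u)]$. Then every $V^s$ is a quadratic form with homogeneous equality constraints, and there are matrices $K^s\in\mathbf R^{m\times n}$ such that the policy $\phi^s(x)=K^sx$ is optimal: for all $s,x$ the finite-horizon costs of $\phi$ converge to $V^s(x)$, so $J_\phi^s(x)=V^s(x)$, and $K^sx$ minimizes $Q^s(x,\cdot)$. -/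

import Mathlib

open MeasureTheory Filter
open scoped ENNReal

universe u

/-- Data `P, q, r, F, g` of an extended quadratic function on `ℝ^ι`: the function
`x ↦ ½ [x; 1]ᵀ [P q; qᵀ r] [x; 1]` on the set `F x + g = 0`, and `+∞` off that set.
There are `p` scalar equality constraints, and `p = 0` is allowed. -/
structure ExtQuad (ι : Type) [Fintype ι] where
  P : Matrix ι ι ℝ
  symm : P.IsSymm
  q : ι → ℝ
  r : ℝ
  p : ℕ
  F : Matrix (Fin p) ι ℝ
  g : Fin p → ℝ

namespace ExtQuad

variable {ι : Type} [Fintype ι]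

open Classical in
/-- The extended-real-valued function given by the data. The block quadratic form
`½ [x; 1]ᵀ [P q; qᵀ r] [x; 1]` is written out as `½ (xᵀ P x + 2 qᵀ x + r)`. -/
noncomputable def eval (f : ExtQuad ι) (x : ι → ℝ) : EReal :=
  if f.F.mulVec x + f.g = 0 then
    (((1 / 2 : ℝ) * (x ⬝ᵥ f.P.mulVec x + 2 * (f.q ⬝ᵥ x) + f.r) : ℝ) : EReal)
  else ⊤

/-- The data describe a quadratic form with homogeneous equality constraints. -/
def IsForm (f : ExtQuad ι) : Prop :=
  f.q = 0 ∧ f.r = 0 ∧ f.g = 0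

end ExtQuad

/-- Convexity of an extended-real-valued function: its epigraph is convex. -/
def ConvexFun {ι : Type} (f : (ι → ℝ) → EReal) : Prop :=
  Convex ℝ {p : (ι → ℝ) × ℝ | f p.1 ≤ (p.2 : EReal)}

/-- `f` is a quadratic form with homogeneous equality constraints. -/
def IsHomQuadForm {ι : Type} [Fintype ι] (f : (ι → ℝ) → EReal) : Prop :=
  ∃ e : ExtQuad ι, e.IsForm ∧ ∀ x, f x = e.eval x

/-- Expectation of an extended-real-valued function, as the integral of the positive part minus
the integral of the negative part. -/
noncomputable def eexp {Ω : Type*} [MeasurableSpace Ω] (μ : Measure Ω) (f : Ω → EReal) : EReal :=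
  ((∫⁻ ω, (f ω).toENNReal ∂μ : ℝ≥0∞) : EReal) - ((∫⁻ ω, (-f ω).toENNReal ∂μ : ℝ≥0∞) : EReal)

/-- The data of one time step of an extended quadratic control problem with state space `ℝⁿ`,
control space `ℝᵐ` and `K` modes: the disturbance space `W` with the law `μ` of the disturbance,
the affine dynamics `A s w x + B s w u + c s w`, an extended quadratic stage cost in `(x, u)` for
each mode, with random quadratic part `P, q, r` and deterministic constraints
`F s x + H s u + h s = 0`, and the mode switching probabilities: `trans i j` is the probability
that the next mode is `i` when the present mode is `j`. -/
structure StepData (n m K : ℕ) where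
  W : Type u
  [mW : MeasurableSpace W]
  μ : Measure W
  [prob : IsProbabilityMeasure μ]
  A : Fin K → W → Matrix (Fin n) (Fin n) ℝ
  B : Fin K → W → Matrix (Fin n) (Fin m) ℝ
  c : Fin K → W → Fin n → ℝ
  P : Fin K → W → Matrix (Fin n ⊕ Fin m) (Fin n ⊕ Fin m) ℝ
  q : Fin K → W → Fin n ⊕ Fin m → ℝ
  r : Fin K → W → ℝ
  p : Fin K → ℕ
  F : ∀ s, Matrix (Fin (p s)) (Fin n) ℝ
  H : ∀ s, Matrix (Fin (p s)) (Fin m) ℝ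
  h : ∀ s, Fin (p s) → ℝ
  trans : Matrix (Fin K) (Fin K) ℝ
  symm : ∀ s w, (P s w).IsSymm
  measurable_A : ∀ s i j, Measurable fun w => A s w i j
  measurable_B : ∀ s i j, Measurable fun w => B s w i j
  measurable_c : ∀ s i, Measurable fun w => c s w i
  measurable_P : ∀ s i j, Measurable fun w => P s w i j
  measurable_q : ∀ s i, Measurable fun w => q s w i
  measurable_r : ∀ s, Measurable (r s)
  trans_nonneg : ∀ i j, 0 ≤ trans i j
  trans_sum : ∀ j, ∑ i, trans i j = 1

attribute [instance] StepData.mW StepData.prob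

namespace StepData

variable {n m K : ℕ}

/-- The state transition function. -/
def next (D : StepData.{u} n m K) (s : Fin K) (x : Fin n → ℝ) (v : Fin m → ℝ) (w : D.W) :
    Fin n → ℝ :=
  (D.A s w).mulVec x + (D.B s w).mulVec v + D.c s w

/-- The stage cost for mode `s` and disturbance `w`, as extended quadratic data in `(x, u)`. -/
def stageQuad (D : StepData.{u} n m K) (s : Fin K) (w : D.W) : ExtQuad (Fin n ⊕ Fin m) where
  P := D.P s w
  symm := D.symm s w
  q := D.q s w
  r := D.r s w
  p := D.p s
  F := Matrix.fromCols (D.F s) (D.H s)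
  g := D.h s

/-- The stage cost function. -/
noncomputable def stage (D : StepData.{u} n m K) (s : Fin K) (x : Fin n → ℝ) (v : Fin m → ℝ)
    (w : D.W) : EReal :=
  (D.stageQuad s w).eval (Sum.elim x v)

/-- The dynamics are linear, without offset. -/
def LinearDynamics (D : StepData.{u} n m K) : Prop :=
  ∀ s w, D.c s w = 0

/-- The stage costs are convex quadratic forms with homogeneous equality constraints. -/
def ConvexFormCost (D : StepData.{u} n m K) : Prop :=
  ∀ s w, (D.stageQuad s w).IsForm ∧ ConvexFun (D.stageQuad s w).eval

/-- The state-action function `E_w E_{s'} [g(x, u, w) + V^{s'}(f(x, u, w))]` in mode `s`. -/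
noncomputable def stateAction (D : StepData.{u} n m K) (V : Fin K → (Fin n → ℝ) → EReal)
    (s : Fin K) (x : Fin n → ℝ) (v : Fin m → ℝ) : EReal :=
  eexp D.μ fun w => ∑ s', (D.trans s' s : EReal) * (D.stage s x v w + V s' (D.next s x v w))

end StepData

section Control

variable {n m K : ℕ}

/-- The state at time `τ` when the system starts at time `t` in state `x` (the state is `x` at all
times up to `t`), under the policies `φ`, disturbances `w` and modes `σ`. -/
def stateAt (S : ℕ → StepData.{u} n m K) (φ : ℕ → Fin K → (Fin n → ℝ) → (Fin m → ℝ))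
    (t : ℕ) (x : Fin n → ℝ) (w : ∀ τ, (S τ).W) (σ : ℕ → Fin K) : ℕ → (Fin n → ℝ)
  | 0 => x
  | τ + 1 =>
    if τ < t then x
    else
      (S τ).next (σ τ) (stateAt S φ t x w σ τ) (φ τ (σ τ) (stateAt S φ t x w σ τ)) (w τ)

/-- The stage cost incurred at time `τ`. -/
noncomputable def stageAt (S : ℕ → StepData.{u} n m K)
    (φ : ℕ → Fin K → (Fin n → ℝ) → (Fin m → ℝ)) (t : ℕ) (x : Fin n → ℝ) (w : ∀ τ, (S τ).W)
    (σ : ℕ → Fin K) (τ : ℕ) : EReal :=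
  (S τ).stage (σ τ) (stateAt S φ t x w σ τ) (φ τ (σ τ) (stateAt S φ t x w σ τ)) (w τ)

/-- The probability of the mode path `σ` over the times `0, …, T` for the Markov chain that starts
at time `t` in mode `s` (the mode is `s` at all times up to `t`). -/
noncomputable def modeProb (S : ℕ → StepData.{u} n m K) (T t : ℕ) (s : Fin K)
    (σ : Fin (T + 1) → Fin K) : ℝ :=
  if ∀ τ : Fin (T + 1), (τ : ℕ) ≤ t → σ τ = s then
    ∏ τ : Fin T, if t ≤ (τ : ℕ) then (S τ).trans (σ τ.succ) (σ τ.castSucc) else 1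
  else 0

/-- The law of the mode path over the times `0, …, T`. -/
noncomputable def modeLaw (S : ℕ → StepData.{u} n m K) (T t : ℕ) (s : Fin K) :
    Measure (Fin (T + 1) → Fin K) :=
  ∑ σ : Fin (T + 1) → Fin K, ENNReal.ofReal (modeProb S T t s σ) • Measure.dirac σ

/-- The joint law of the disturbances and of the mode path: the disturbances at different times
are independent of each other and of the modes. -/
noncomputable def trajLaw (S : ℕ → StepData.{u} n m K) (T t : ℕ) (s : Fin K) :
    Measure ((∀ τ, (S τ).W) × (Fin (T + 1) → Fin K)) :=
  (Measure.infinitePi fun τ => (S τ).μ).prod (modeLaw S T t s)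

/-- A mode path over the times `0, …, T` as a sequence; the values after time `T` play no role. -/
def extendPath {T : ℕ} (σ : Fin (T + 1) → Fin K) (τ : ℕ) : Fin K :=
  σ (Fin.ofNat (T + 1) τ)

/-- The expected cost over the times `t, …, T`, with final cost `gT`, of the policies `φ` from
state `x` and mode `s` at time `t ≤ T`. -/
noncomputable def finiteCost (S : ℕ → StepData.{u} n m K) (T : ℕ) (gT : Fin K → ExtQuad (Fin n))
    (φ : ℕ → Fin K → (Fin n → ℝ) → (Fin m → ℝ)) (t : ℕ) (s : Fin K) (x : Fin n → ℝ) : EReal :=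
  eexp (trajLaw S T t s) fun ω =>
    ∑ τ ∈ Finset.Ico t T, stageAt S φ t x ω.1 (extendPath ω.2) τ
      + (gT (extendPath ω.2 T)).eval (stateAt S φ t x ω.1 (extendPath ω.2) T)

/-- The cost-to-go function at time `t ≤ T` of the finite-horizon problem: the infimum of the
expected cost over all (Borel measurable) policies. -/
noncomputable def finiteCostToGo (S : ℕ → StepData.{u} n m K) (T : ℕ)
    (gT : Fin K → ExtQuad (Fin n)) (t : ℕ) (s : Fin K) (x : Fin n → ℝ) : EReal :=
  ⨅ (φ : ℕ → Fin K → (Fin n → ℝ) → (Fin m → ℝ)) (_ : ∀ τ s', Measurable (φ τ s')),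
    finiteCost S T gT φ t s x

/-- The expected discounted cost over the times `0, …, N` of the time-invariant policy `φ`, for
time-invariant data `D`. -/
noncomputable def discountedCost (D : StepData.{u} n m K) (γ : ℝ)
    (φ : Fin K → (Fin n → ℝ) → (Fin m → ℝ)) (s : Fin K) (x : Fin n → ℝ) (N : ℕ) : EReal :=
  eexp (trajLaw (fun _ => D) (N + 1) 0 s) fun ω =>
    ∑ τ ∈ Finset.range (N + 1),
      ((γ ^ τ : ℝ) : EReal) * stageAt (fun _ => D) (fun _ => φ) 0 x ω.1 (extendPath ω.2) τ

/-- The infinite-horizon cost: the limit of the costs over finite horizons, written as an upper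
limit, which is the limit whenever the limit exists. -/
noncomputable def infiniteCost (D : StepData.{u} n m K) (γ : ℝ)
    (φ : Fin K → (Fin n → ℝ) → (Fin m → ℝ)) (s : Fin K) (x : Fin n → ℝ) : EReal :=
  limsup (discountedCost D γ φ s x) atTop

/-- The cost-to-go function of the infinite-horizon problem: the infimum of the infinite-horizon
cost over all (Borel measurable) time-invariant policies. -/
noncomputable def infiniteCostToGo (D : StepData.{u} n m K) (γ : ℝ) (s : Fin K)
    (x : Fin n → ℝ) : EReal :=
  ⨅ (φ : Fin K → (Fin n → ℝ) → (Fin m → ℝ)) (_ : ∀ s', Measurable (φ s')),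
    infiniteCost D γ φ s x

end Control

/-! ### Algebra of quadratic forms with values in `[0, ∞]`. -/

section ENNQuadraticForms

/-! A convex form with homogeneous constraints is nonnegative, so all costs live in `[0, ∞]`, where
expectations need no integrability. There such forms are characterized by two identities, quadratic
homogeneity and the parallelogram law (`IsENNQuadForm`). The identities survive sums, nonnegative
multiples, linear substitution, integration, increasing limits and partial minimization, hence every
operation of dynamic programming, even when values become infinite. Conversely, the Jordan–von
Neumann argument turns the identities back into a positive semidefinite form on a subspace
(`IsENNQuadForm.exists_bilinForm`), which is the matrix description with constraints.

Linear policies come from `IsENNQuadForm.exists_linear_minimizer`: the points that minimize on their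
fibre include a linear subspace, cut out by orthogonality to the feasible control directions, and
this subspace has a linear section. A linear minimizer is measurable, so no selection theorem
enters. Together with the recursion `policyCost_eq_succ` for the cost of a fixed policy, backward
induction gives the finite horizon.

For the infinite horizon, let `W` be the increasing limit of value iteration from zero. Each iterate
bounds from below the cost of every policy over the corresponding horizon. The linear policy that
minimizes the state-action function of `W` costs at most `W`, provided that minimization commutes
with the increasing limit. This is `stateActionENN_valueLim_le`; it rests on the compactness
statement `IsENNQuadForm.exists_forall_le`, where directions of zero cost are removed first.
Squeezing gives convergence and optimality. -/

/-- An additive function on `ℝ` that is bounded on the unit interval is linear. -/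
theorem additive_eq_mul_of_bound (φ : ℝ → ℝ) (hadd : ∀ a b, φ (a + b) = φ a + φ b) (C : ℝ)
    (hC : ∀ a, 0 ≤ a → a ≤ 1 → |φ a| ≤ C) (a : ℝ) : φ a = a * φ 1 := by
  let Φ : ℝ →+ ℝ := AddMonoidHom.mk' φ hadd
  let d : ℝ →+ ℝ := Φ - (AddMonoidHom.mulRight (φ 1))
  have hd : ∀ b, d b = φ b - b * φ 1 := fun b => rfl
  have hd1 : d 1 = 0 := by rw [hd]; ring
  -- Since `d 1 = 0`, the additive map `d` is 1-periodic, so its bound on the unit interval is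
  -- global. A globally bounded additive map is zero, because `d (N • a) = N * d a`.
  have hbd : ∀ b, |d b| ≤ C + |φ 1| := by
    intro b
    have h1 : d b = d (Int.fract b) := by
      have : d b = d (Int.fract b) + d ((⌊b⌋ : ℤ) • (1 : ℝ)) := by
        rw [← map_add]; congr 1; simp
      rw [this, map_zsmul, hd1]; simp
    rw [h1, hd]
    have h2 := hC _ (Int.fract_nonneg b) (Int.fract_lt_one b).le
    have h3 : |Int.fract b * φ 1| ≤ |φ 1| := by
      rw [abs_mul, abs_of_nonneg (Int.fract_nonneg b)]
      exact mul_le_of_le_one_left (abs_nonneg _) (Int.fract_lt_one b).le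
    exact (abs_sub _ _).trans (add_le_add h2 h3)
  have hda : d a = 0 := by
    by_contra hne
    have hpos : 0 < |d a| := abs_pos.mpr hne
    obtain ⟨N, hN⟩ := exists_nat_gt ((C + |φ 1|) / |d a|)
    have h1 := hbd (N • a)
    rw [map_nsmul, nsmul_eq_mul, abs_mul, Nat.abs_cast] at h1
    rw [div_lt_iff₀ hpos] at hN
    linarith
  rw [hd] at hda
  linarith

/-- A nonnegative, quadratically homogeneous function that satisfies the parallelogram law comes
from a bilinear form. -/
theorem exists_bilinForm_of_parallelogram {M : Type*} [AddCommGroup M] [Module ℝ M] (q : M → ℝ)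
    (h0 : ∀ x, 0 ≤ q x) (hs : ∀ (a : ℝ) x, q (a • x) = a ^ 2 * q x)
    (hp : ∀ x y, q (x + y) + q (x - y) = 2 * (q x + q y)) :
    ∃ B : LinearMap.BilinForm ℝ M, (∀ x y, B x y = B y x) ∧ ∀ x, B x x = q x := by
  let p : M → M → ℝ := fun x y => (q (x + y) - q x - q y) / 2
  have hcomm : ∀ x y, p x y = p y x := fun x y => by simp only [p]; rw [add_comm x y]; ring
  -- Jordan–von Neumann: additivity of the polar form is the combination `e1 - e2 + e3 + 2 * e4` of
  -- four parallelograms, up to a factor.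
  have hadd : ∀ x z y, p (x + z) y = p x y + p z y := by
    intro x z y
    have e1 := hp (x + y) z
    have e2 := hp x (y - z)
    have e3 := hp (x + z) y
    have e4 := hp y z
    have r1 : x + y + z = x + z + y := by abel
    have r2 : x + (y - z) = x + y - z := by abel
    have r3 : x - (y - z) = x + z - y := by abel
    have r4 : z + y = y + z := by abel
    rw [r1] at e1
    rw [r2, r3] at e2
    simp only [p]
    rw [r4]
    linarith
  -- Nonnegativity of `q` replaces continuity: it bounds the additive map `a ↦ p (a • x) y` on the
  -- unit interval.
  have hsm : ∀ (a : ℝ) x y, p (a • x) y = a * p x y := by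
    intro a x y
    have key := additive_eq_mul_of_bound (fun a => p (a • x) y)
      (fun a b => by rw [add_smul, hadd]) (q x + q y) ?_ a
    · simpa using key
    · intro b hb0 hb1
      have hb2 : b ^ 2 ≤ 1 := pow_le_one₀ hb0 hb1
      have hbq : b ^ 2 * q x ≤ q x := mul_le_of_le_one_left (h0 x) hb2
      have e := hp (b • x) y
      have e1 := h0 (b • x + y)
      have e2 := h0 (b • x - y)
      have e3 := hs b x
      have e4 := h0 x
      have e5 := h0 y
      simp only [p, abs_le]
      constructor <;> linarith
  refine ⟨LinearMap.mk₂ ℝ p hadd hsm (fun x y z => ?_) (fun a x y => ?_), hcomm, fun x => ?_⟩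
  · rw [hcomm, hadd, hcomm y, hcomm z]
  · rw [hcomm, hsm, hcomm y]; rfl
  · have h := hs 2 x
    simp only [LinearMap.mk₂_apply, p]
    rw [← two_smul ℝ x, h]
    ring

/-- Nonnegative quadratic forms with values in `[0, ∞]`: quadratic homogeneity and the
parallelogram law. -/
structure IsENNQuadForm {E : Type*} [AddCommGroup E] [Module ℝ E] (f : E → ℝ≥0∞) : Prop where
  smul : ∀ (a : ℝ) x, f (a • x) = ENNReal.ofReal (a ^ 2) * f x
  para : ∀ x y, f (x + y) + f (x - y) = 2 * (f x + f y)

namespace IsENNQuadForm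

variable {E F : Type*} [AddCommGroup E] [Module ℝ E] [AddCommGroup F] [Module ℝ F]

/-- The convention `0 * ⊤ = 0` makes homogeneity at `a = 0` force this even where `f` is infinite.
-/
theorem map_zero {f : E → ℝ≥0∞} (hf : IsENNQuadForm f) : f 0 = 0 := by
  simpa using hf.smul 0 0

theorem add_le {f : E → ℝ≥0∞} (hf : IsENNQuadForm f) (x y : E) :
    f (x + y) ≤ 2 * (f x + f y) := by
  rw [← hf.para]; exact le_self_add

theorem sub_le {f : E → ℝ≥0∞} (hf : IsENNQuadForm f) (x y : E) :
    f (x - y) ≤ 2 * (f x + f y) := by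
  rw [← hf.para]; exact le_add_self

protected theorem zero : IsENNQuadForm (fun _ : E => (0 : ℝ≥0∞)) :=
  ⟨fun a x => by simp, fun x y => by simp⟩

theorem add {f g : E → ℝ≥0∞} (hf : IsENNQuadForm f) (hg : IsENNQuadForm g) :
    IsENNQuadForm (fun x => f x + g x) :=
  ⟨fun a x => by rw [hf.smul, hg.smul, mul_add], fun x y => by
    rw [add_add_add_comm, hf.para, hg.para]; ring⟩

theorem const_mul {f : E → ℝ≥0∞} (hf : IsENNQuadForm f) (c : ℝ≥0∞) :
    IsENNQuadForm (fun x => c * f x) :=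
  ⟨fun a x => by rw [hf.smul]; ring, fun x y => by rw [← mul_add, hf.para]; ring⟩

theorem finset_sum {ι : Type*} (s : Finset ι) {f : ι → E → ℝ≥0∞}
    (hf : ∀ i, IsENNQuadForm (f i)) : IsENNQuadForm (fun x => ∑ i ∈ s, f i x) := by
  classical
  induction s using Finset.induction_on with
  | empty => simpa using IsENNQuadForm.zero
  | insert i s hi ih => simpa [Finset.sum_insert hi] using (hf i).add ih

theorem comp {f : F → ℝ≥0∞} (hf : IsENNQuadForm f) (L : E →ₗ[ℝ] F) :
    IsENNQuadForm (fun x => f (L x)) :=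
  ⟨fun a x => by rw [_root_.map_smul, hf.smul], fun x y => by
    rw [map_add, map_sub, hf.para]⟩

theorem lintegral {Ω : Type*} [MeasurableSpace Ω] (μ : Measure Ω) {f : Ω → E → ℝ≥0∞}
    (hf : ∀ ω, IsENNQuadForm (f ω)) (hm : ∀ x, Measurable fun ω => f ω x) :
    IsENNQuadForm (fun x => ∫⁻ ω, f ω x ∂μ) := by
  refine ⟨fun a x => ?_, fun x y => ?_⟩
  · rw [← lintegral_const_mul _ (hm x)]
    exact lintegral_congr fun ω => (hf ω).smul a x
  · rw [← lintegral_add_left (hm _), ← lintegral_add_left (hm _)]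
    exact (lintegral_congr fun ω => (hf ω).para x y).trans
      (lintegral_const_mul 2 ((hm x).add (hm y)))

theorem iSup {f : ℕ → E → ℝ≥0∞} (hf : ∀ k, IsENNQuadForm (f k)) (hmono : Monotone f) :
    IsENNQuadForm (fun x => ⨆ k, f k x) := by
  refine ⟨fun a x => ?_, fun x y => ?_⟩
  · rw [ENNReal.mul_iSup]
    exact iSup_congr fun k => (hf k).smul a x
  · have hm : ∀ z, Monotone fun k => f k z := fun z i j hij => hmono hij z
    rw [ENNReal.iSup_add_iSup_of_monotone (hm _) (hm _),
      ENNReal.iSup_add_iSup_of_monotone (hm _) (hm _), ENNReal.mul_iSup]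
    exact iSup_congr fun k => (hf k).para x y

/-- Partial minimization preserves quadratic forms. -/
theorem partial_iInf {f : E × F → ℝ≥0∞} (hf : IsENNQuadForm f) :
    IsENNQuadForm (fun x => ⨅ u, f (x, u)) := by
  -- Controls `u` for `x` and `v` for `y` yield the candidates `u + v` and `u - v` for `x + y` and
  -- `x - y`.
  have hle : ∀ x y, (⨅ u, f (x + y, u)) + (⨅ u, f (x - y, u))
      ≤ 2 * ((⨅ u, f (x, u)) + ⨅ u, f (y, u)) := by
    intro x y
    have e : 2 * ((⨅ u, f (x, u)) + ⨅ u, f (y, u)) = ⨅ u, ⨅ v, 2 * (f (x, u) + f (y, v)) := by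
      rw [ENNReal.iInf_add, ENNReal.mul_iInf_of_ne two_ne_zero ENNReal.ofNat_ne_top]
      refine iInf_congr fun u => ?_
      rw [ENNReal.add_iInf, ENNReal.mul_iInf_of_ne two_ne_zero ENNReal.ofNat_ne_top]
    rw [e]
    refine le_iInf fun u => le_iInf fun v => ?_
    rw [← hf.para]
    exact add_le_add (iInf_le _ (u + v)) (iInf_le _ (u - v))
  have hsle : ∀ (a : ℝ) x, (⨅ u, f (a • x, u)) ≤ ENNReal.ofReal (a ^ 2) * ⨅ u, f (x, u) := by
    intro a x
    -- At `a = 0` the right side is zero even if the infimum is infinite; the control `0` attains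
    -- it.
    rcases eq_or_ne a 0 with rfl | ha
    · refine (iInf_le _ 0).trans ?_
      rw [zero_smul]
      exact (hf.map_zero (E := E × F)).le.trans zero_le
    · have : ENNReal.ofReal (a ^ 2) ≠ 0 := by
        simpa using ha
      rw [ENNReal.mul_iInf_of_ne this ENNReal.ofReal_ne_top]
      refine le_iInf fun u => (iInf_le _ (a • u)).trans ?_
      rw [← hf.smul]
      exact le_rfl
  have hsmul : ∀ (a : ℝ) x, (⨅ u, f (a • x, u)) = ENNReal.ofReal (a ^ 2) * ⨅ u, f (x, u) := by
    intro a x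
    refine le_antisymm (hsle a x) ?_
    rcases eq_or_ne a 0 with rfl | ha
    · simp
    · have h := hsle a⁻¹ (a • x)
      rw [inv_smul_smul₀ ha] at h
      calc _ ≤ ENNReal.ofReal (a ^ 2) * (ENNReal.ofReal (a⁻¹ ^ 2) * ⨅ u, f (a • x, u)) := by
            gcongr
        _ = _ := by
          rw [← mul_assoc, ← ENNReal.ofReal_mul (sq_nonneg a), ← mul_pow, mul_inv_cancel₀ ha]
          simp
  refine ⟨hsmul, fun x y => le_antisymm (hle x y) ?_⟩
  -- The reverse inequality is the same one at the sum and difference; homogeneity yields a factor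
  -- 4, of which one 2 cancels.
  have h := hle (x + y) (x - y)
  have e1 : x + y + (x - y) = (2 : ℝ) • x := by rw [two_smul]; abel
  have e2 : x + y - (x - y) = (2 : ℝ) • y := by rw [two_smul]; abel
  rw [e1, e2, hsmul, hsmul, ← mul_add] at h
  have e3 : ENNReal.ofReal ((2 : ℝ) ^ 2) = 2 * 2 := by
    rw [← ENNReal.ofReal_ofNat, ← ENNReal.ofReal_mul (by norm_num)]; norm_num
  rw [e3, mul_assoc] at h
  exact (ENNReal.mul_le_mul_iff_right (by simp) (by simp)).mp h

/-- The subspace where a quadratic form is finite. -/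
def domain {f : E → ℝ≥0∞} (hf : IsENNQuadForm f) : Submodule ℝ E where
  carrier := {x | f x ≠ ⊤}
  add_mem' := by
    intro x y hx hy
    exact ne_top_of_le_ne_top (ENNReal.mul_ne_top (by simp) (ENNReal.add_ne_top.mpr ⟨hx, hy⟩))
      (hf.add_le x y)
  zero_mem' := by simp [hf.map_zero]
  smul_mem' := by
    intro a x hx
    change f (a • x) ≠ ⊤
    rw [hf.smul]
    exact ENNReal.mul_ne_top ENNReal.ofReal_ne_top hx

open Classical in
/-- A quadratic form with values in `[0, ∞]` is a positive semidefinite form on a subspace, and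
`∞` off it. -/
theorem exists_bilinForm {f : E → ℝ≥0∞} (hf : IsENNQuadForm f) :
    ∃ (D : Submodule ℝ E) (B : LinearMap.BilinForm ℝ E), (∀ x y, B x y = B y x) ∧
      (∀ x, 0 ≤ B x x) ∧ ∀ x, f x = if x ∈ D then ENNReal.ofReal (B x x) else ⊤ := by
  have hD : ∀ x : hf.domain, f x ≠ ⊤ := fun x => x.2
  obtain ⟨B, hsymm, hB⟩ := exists_bilinForm_of_parallelogram
    (fun x : hf.domain => (f x).toReal) (fun x => ENNReal.toReal_nonneg)
    (fun a x => by
      simp only [Submodule.coe_smul]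
      rw [hf.smul, ENNReal.toReal_mul, ENNReal.toReal_ofReal (sq_nonneg a)])
    (fun x y => by
      rw [← ENNReal.toReal_add (hD _) (hD _)]
      simp only [Submodule.coe_add, Submodule.coe_sub]
      rw [hf.para, ENNReal.toReal_mul, ENNReal.toReal_add (hD _) (hD _)]
      simp)
  -- Any projection onto the domain extends the form to all of `E`; its values off the domain are
  -- irrelevant, but it stays positive semidefinite there.
  obtain ⟨π, hπ⟩ := hf.domain.subtype.exists_leftInverse_of_injective
    (Submodule.ker_subtype _)
  have hπ' : ∀ x : hf.domain, π (x : E) = x := fun x => LinearMap.congr_fun hπ x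
  refine ⟨hf.domain, B.compl₁₂ π π, fun x y => hsymm _ _, fun x => ?_, fun x => ?_⟩
  · simp only [LinearMap.compl₁₂_apply]
    rw [hB]; exact ENNReal.toReal_nonneg
  · split_ifs with hx
    · have := hπ' ⟨x, hx⟩
      simp only [LinearMap.compl₁₂_apply]
      rw [hB, this, ENNReal.ofReal_toReal hx]
    · by_contra h
      exact hx h

/-- Vectors of value zero are directions of invariance. -/
theorem add_of_eq_zero {f : E → ℝ≥0∞} (hf : IsENNQuadForm f) {y : E} (hy : f y = 0) (x : E) :
    f (x + y) = f x := by
  obtain ⟨D, B, hs, h0, h⟩ := hf.exists_bilinForm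
  have hyD : y ∈ D := by
    by_contra hn
    rw [h, if_neg hn] at hy
    exact absurd hy (by simp)
  rw [h, if_pos hyD, ENNReal.ofReal_eq_zero] at hy
  have hy0 : B y y = 0 := le_antisymm hy (h0 y)
  -- Cauchy–Schwarz: a null vector of a semidefinite form is orthogonal to everything.
  have hxy : B x y = 0 := by
    have := LinearMap.BilinForm.apply_sq_le_of_symm B h0 ⟨fun a b => hs a b⟩ x y
    rw [hy0, mul_zero] at this
    exact pow_eq_zero_iff (two_ne_zero) |>.mp (le_antisymm this (sq_nonneg _))
  have : B (x + y) (x + y) = B x x := by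
    simp only [map_add, LinearMap.add_apply]
    rw [hs y x, hxy, hy0]; ring
  rw [h, h, this, Submodule.add_mem_iff_left D hyD]

end IsENNQuadForm

/-- Orthogonal projection along a subspace with respect to a positive semidefinite form. -/
theorem exists_sub_orthogonal {E : Type*} [AddCommGroup E] [Module ℝ E] [FiniteDimensional ℝ E]
    (B : LinearMap.BilinForm ℝ E) (hs : ∀ x y, B x y = B y x) (h0 : ∀ x, 0 ≤ B x x)
    (N : Submodule ℝ E) (z : E) : ∃ n ∈ N, ∀ n' ∈ N, B (z - n) n' = 0 := by
  -- The form may degenerate on `N`, so its null part is split off: on `C' ⊓ N` the form is definite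
  -- and an orthogonal complement exists, while the discarded part is orthogonal to everything.
  obtain ⟨C', hC'⟩ := (Submodule.exists_isCompl (N ⊓ LinearMap.ker B))
  have hker : ∀ x, B x x = 0 → x ∈ LinearMap.ker B := by
    intro x hx
    rw [LinearMap.mem_ker]
    ext y
    have := LinearMap.BilinForm.apply_sq_le_of_symm B h0 ⟨fun a b => hs a b⟩ x y
    rw [hx, zero_mul] at this
    exact pow_eq_zero_iff (two_ne_zero) |>.mp (le_antisymm this (sq_nonneg _))
  have hsym : B.IsSymm := ⟨fun a b => hs a b⟩
  have hnd : (B.restrict (C' ⊓ N)).Nondegenerate := by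
    have aux : ∀ c : (C' ⊓ N : Submodule ℝ E), B c c = 0 → c = 0 := by
      intro c hc
      have h1 : (c : E) ∈ (N ⊓ LinearMap.ker B) ⊓ C' := ⟨⟨c.2.2, hker _ hc⟩, c.2.1⟩
      rw [hC'.inf_eq_bot] at h1
      exact Subtype.ext h1
    exact ⟨fun c hc => aux c (hc c), fun c hc => aux c (hc c)⟩
  have hcompl := LinearMap.BilinForm.isCompl_orthogonal_of_restrict_nondegenerate hsym.isRefl hnd
  have hz : z ∈ (C' ⊓ N) ⊔ B.orthogonal (C' ⊓ N) := by rw [hcompl.sup_eq_top]; trivial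
  obtain ⟨c, hc, z', hz', rfl⟩ := Submodule.mem_sup.mp hz
  refine ⟨c, hc.2, fun n' hn' => ?_⟩
  have hn : n' ∈ (N ⊓ LinearMap.ker B) ⊔ C' := by rw [hC'.sup_eq_top]; trivial
  obtain ⟨k, hk, c', hc', rfl⟩ := Submodule.mem_sup.mp hn
  have hc'N : c' ∈ N := by simpa using N.sub_mem hn' hk.1
  have h1 : B c' z' = 0 := hz' c' ⟨hc', hc'N⟩
  have h2 : B k z' = 0 := by rw [LinearMap.mem_ker.mp hk.2]; rfl
  rw [add_sub_cancel_left, hs, map_add, LinearMap.add_apply, h1, h2, add_zero]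

namespace IsENNQuadForm

/-- The partial minimum of a quadratic form is attained at a linear function. -/
theorem exists_linear_minimizer {E F : Type*} [AddCommGroup E] [Module ℝ E] [AddCommGroup F]
    [Module ℝ F] [FiniteDimensional ℝ E] [FiniteDimensional ℝ F] {f : E × F → ℝ≥0∞}
    (hf : IsENNQuadForm f) : ∃ L : E →ₗ[ℝ] F, ∀ x v, f (x, L x) ≤ f (x, v) := by
  obtain ⟨D, B, hs, h0, h⟩ := hf.exists_bilinForm
  -- `N` collects the feasible directions within a fibre, and `G` below the feasible points at which
  -- the first-order condition along `N` holds.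
  let N : Submodule ℝ (E × F) := D ⊓ LinearMap.ker (LinearMap.fst ℝ E F)
  let G : Submodule ℝ (E × F) :=
    { carrier := {z | z ∈ D ∧ ∀ n ∈ N, B z n = 0}
      add_mem' := fun {a b} ha hb => ⟨D.add_mem ha.1 hb.1, fun n hn => by
        rw [map_add, LinearMap.add_apply, ha.2 n hn, hb.2 n hn, add_zero]⟩
      zero_mem' := ⟨D.zero_mem, fun n _ => by simp⟩
      smul_mem' := fun a z hz => ⟨D.smul_mem a hz.1, fun n hn => by
        rw [_root_.map_smul, LinearMap.smul_apply, hz.2 n hn, smul_zero]⟩ }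
  have hGmin : ∀ z ∈ G, ∀ v, f z ≤ f (z.1, v) := by
    intro z hz v
    by_cases hv : (z.1, v) ∈ D
    · rw [h z, h (z.1, v), if_pos hz.1, if_pos hv]
      apply ENNReal.ofReal_le_ofReal
      have hn : (z.1, v) - z ∈ N := ⟨D.sub_mem hv hz.1, by simp⟩
      have e1 := hz.2 _ hn
      have e2 : B (z.1, v) (z.1, v)
          = B z z + 2 * B z ((z.1, v) - z) + B ((z.1, v) - z) ((z.1, v) - z) := by
        simp only [map_sub, LinearMap.sub_apply]
        rw [hs (z.1, v) z]; ring
      rw [e2, e1]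
      linarith [h0 ((z.1, v) - z)]
    · rw [h (z.1, v), if_neg hv]; exact le_top
  let p : G →ₗ[ℝ] E := (LinearMap.fst ℝ E F) ∘ₗ G.subtype
  -- Minimizers need not be unique, so a linear section `σ` chooses one; `π` extends the choice to
  -- states with no feasible control, where every value is `⊤`.
  obtain ⟨σ, hσ⟩ := LinearMap.exists_rightInverse_of_surjective p.rangeRestrict
    p.range_rangeRestrict
  obtain ⟨π, hπ⟩ := (LinearMap.range p).subtype.exists_leftInverse_of_injective
    (Submodule.ker_subtype _)
  refine ⟨(LinearMap.snd ℝ E F) ∘ₗ G.subtype ∘ₗ σ ∘ₗ π, fun x v => ?_⟩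
  by_cases hv : (x, v) ∈ D
  · have hx : x ∈ LinearMap.range p := by
      obtain ⟨n, hn, hn'⟩ := exists_sub_orthogonal B hs h0 N (x, v)
      have hn1 : n.1 = 0 := hn.2
      exact ⟨⟨(x, v) - n, D.sub_mem hv hn.1, hn'⟩, by simp [p, hn1]⟩
    have h1 : π x = ⟨x, hx⟩ := LinearMap.congr_fun hπ ⟨x, hx⟩
    have h2 : p (σ ⟨x, hx⟩) = x := by
      have := LinearMap.congr_fun hσ ⟨x, hx⟩
      exact congrArg Subtype.val this
    have h3 := hGmin _ (σ ⟨x, hx⟩).2 v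
    have h4 : ((σ ⟨x, hx⟩ : G) : E × F).1 = x := h2
    have h5 : (x, ((LinearMap.snd ℝ E F) ∘ₗ G.subtype ∘ₗ σ ∘ₗ π) x)
        = ((σ ⟨x, hx⟩ : G) : E × F) := by
      simp only [LinearMap.comp_apply, h1]
      exact Prod.ext h4.symm rfl
    rw [h5]
    rwa [h4] at h3
  · rw [h (x, v), if_neg hv]; exact le_top

end IsENNQuadForm

end ENNQuadraticForms

/-! ### Closedness and compactness of sublevel sets; passage to and from matrix data. -/

section Topology

namespace IsENNQuadForm

variable {E F : Type*} [NormedAddCommGroup E] [NormedSpace ℝ E] [FiniteDimensional ℝ E]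
  [NormedAddCommGroup F] [NormedSpace ℝ F] [FiniteDimensional ℝ F]

/-- Quadratic forms have closed sublevel sets. -/
theorem isClosed_le {f : E → ℝ≥0∞} (hf : IsENNQuadForm f) (c : ℝ≥0∞) : IsClosed {x | f x ≤ c} := by
  obtain ⟨D, B, -, h0, h⟩ := hf.exists_bilinForm
  rcases eq_or_ne c ⊤ with rfl | hc
  · simp
  have hB : Continuous fun x => B x x := by
    let L : E →ₗ[ℝ] (E →L[ℝ] ℝ) := (LinearMap.toContinuousLinearMap (𝕜 := ℝ)).toLinearMap ∘ₗ B
    have hL : Continuous L := L.continuous_of_finiteDimensional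
    exact hL.clm_apply continuous_id
  have : {x | f x ≤ c} = (D : Set E) ∩ {x | ENNReal.ofReal (B x x) ≤ c} := by
    ext x
    change f x ≤ c ↔ x ∈ D ∧ ENNReal.ofReal (B x x) ≤ c
    rw [h]
    split_ifs with hx <;> simp [hx, hc]
  rw [this]
  exact D.closed_of_finiteDimensional.inter
    (_root_.isClosed_le (ENNReal.continuous_ofReal.comp hB) continuous_const)

theorem measurable [MeasurableSpace E] [BorelSpace E] {f : E → ℝ≥0∞} (hf : IsENNQuadForm f) :
    Measurable f :=
  measurable_of_Iic fun c => (hf.isClosed_le c).measurableSet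

/-- Sublevel sets of a quadratic form are bounded on a subspace on which it is definite. -/
theorem isBounded_le {f : E → ℝ≥0∞} (hf : IsENNQuadForm f) (C : Submodule ℝ E)
    (hC : ∀ x ∈ C, f x = 0 → x = 0) {c : ℝ≥0∞} (hc : c ≠ ⊤) :
    Bornology.IsBounded {x | x ∈ C ∧ f x ≤ c} := by
  let S : Set E := (C : Set E) ∩ Metric.sphere 0 1
  have hS : IsCompact S := (isCompact_sphere 0 1).inter_left C.closed_of_finiteDimensional
  have hnonneg : ∀ x ∈ S, f x ≠ 0 := by
    intro x hx h
    have := hC x hx.1 h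
    have h1 := hx.2
    simp [this] at h1
  obtain ⟨ε, hε, hle⟩ : ∃ ε : ℝ, 0 < ε ∧ ∀ x ∈ S, ENNReal.ofReal ε ≤ f x := by
    rcases S.eq_empty_or_nonempty with hS0 | hS0
    · exact ⟨1, one_pos, fun x hx => by simp [hS0] at hx⟩
    have hlsc : LowerSemicontinuous f :=
      lowerSemicontinuous_iff_isClosed_preimage.mpr fun c => hf.isClosed_le c
    obtain ⟨x0, hx0, hmin⟩ := LowerSemicontinuousOn.exists_isMinOn hS0 hS
      (hlsc.lowerSemicontinuousOn S)
    -- The minimum over the sphere may be `⊤`; truncation at 1 keeps `ε` real.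
    have hpos : 0 < min (f x0) 1 := lt_min (pos_iff_ne_zero.mpr (hnonneg x0 hx0)) one_pos
    have hfin : min (f x0) 1 ≠ ⊤ := ne_top_of_le_ne_top ENNReal.one_ne_top (min_le_right _ _)
    refine ⟨(min (f x0) 1).toReal, ENNReal.toReal_pos hpos.ne' hfin, fun x hx => ?_⟩
    rw [ENNReal.ofReal_toReal hfin]
    exact (min_le_left _ _).trans (hmin hx)
  -- The summand 1 gives `‖x‖ > 1` beyond this radius, so that `‖x‖ ^ 2 * ε ≥ ‖x‖ * ε > c`.
  refine (Metric.isBounded_iff_subset_closedBall 0).mpr ⟨1 + c.toReal / ε, ?_⟩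
  rintro x ⟨hxC, hx⟩
  rw [mem_closedBall_zero_iff]
  by_contra! hlt
  have hc0 : 0 ≤ c.toReal / ε := div_nonneg ENNReal.toReal_nonneg hε.le
  have hx1 : 1 < ‖x‖ := by linarith
  have hx0 : ‖x‖ ≠ 0 := by linarith
  have hmem : ‖x‖⁻¹ • x ∈ S := ⟨C.smul_mem _ hxC, by simp [norm_smul, hx0]⟩
  have h1 := hle _ hmem
  have h2 : f x = ENNReal.ofReal (‖x‖ ^ 2) * f (‖x‖⁻¹ • x) := by
    rw [← hf.smul, smul_inv_smul₀ hx0]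
  have h3 : ENNReal.ofReal (‖x‖ ^ 2 * ε) ≤ c := by
    rw [ENNReal.ofReal_mul (sq_nonneg _)]
    refine le_trans ?_ hx
    rw [h2]
    gcongr
  have h4 : ‖x‖ ^ 2 * ε ≤ c.toReal := (ENNReal.ofReal_le_iff_le_toReal hc).mp h3
  have h5 : c.toReal / ε < ‖x‖ := by linarith
  rw [div_lt_iff₀ hε] at h5
  nlinarith [mul_pos (sub_pos.mpr hx1) (mul_pos (zero_lt_one.trans hx1) hε)]

/-- For an increasing sequence of quadratic forms, a level that every form reaches on a fibre is
reached at a common point of the fibre. -/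
theorem exists_forall_le {f : ℕ → E × F → ℝ≥0∞} (hf : ∀ k, IsENNQuadForm (f k))
    (hmono : Monotone f) (x : E) (c : ℝ≥0∞) (h : ∀ k, ∃ u, f k (x, u) ≤ c) :
    ∃ u, ∀ k, f k (x, u) ≤ c := by
  rcases eq_or_ne c ⊤ with rfl | hc
  · exact ⟨0, fun _ => le_top⟩
  have hg : ∀ k, IsENNQuadForm fun u => f k (0, u) := fun k => (hf k).comp (LinearMap.inr ℝ E F)
  -- The null directions in the fibre decrease with `k`, hence stabilize. Modulo the stable space
  -- the sublevel sets are compact and nested, and Cantor's intersection theorem applies.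
  let N : ℕ → Submodule ℝ F := fun k =>
    { carrier := {u | f k (0, u) = 0}
      add_mem' := fun {a b} ha hb => by
        have := (hg k).add_of_eq_zero hb a
        exact this.trans ha
      zero_mem' := (hf k).map_zero
      smul_mem' := fun a u hu => by
        have h1 := (hg k).smul a u
        have h2 : f k (0, u) = 0 := hu
        simp only [h2, mul_zero] at h1
        exact h1 }
  have hNanti : ∀ {i j}, i ≤ j → N j ≤ N i := by
    intro i j hij u hu
    have h2 : f j (0, u) = 0 := hu
    exact le_antisymm (h2 ▸ hmono hij (0, u)) zero_le
  obtain ⟨k0, hk0⟩ := IsArtinian.monotone_stabilizes (R := ℝ) (M := F)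
    ⟨fun k => OrderDual.toDual (N k), fun i j hij => hNanti hij⟩
  have hN : ∀ k, k0 ≤ k → N k = N k0 := fun k hk => (OrderDual.toDual.injective (hk0 k hk)).symm
  obtain ⟨C, hC⟩ := (N k0).exists_isCompl
  let S : ℕ → Set F := fun k => {u | u ∈ C ∧ f (k0 + k) (x, u) ≤ c}
  have hclosed : ∀ k, IsClosed (S k) := fun k => C.closed_of_finiteDimensional.inter
    (((hf (k0 + k)).isClosed_le c).preimage (Continuous.prodMk_right x))
  have hne : ∀ k, (S k).Nonempty := by
    intro k
    obtain ⟨u, hu⟩ := h (k0 + k)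
    have : u ∈ N k0 ⊔ C := by rw [hC.sup_eq_top]; trivial
    obtain ⟨n, hn, u', hu', rfl⟩ := Submodule.mem_sup.mp this
    refine ⟨u', hu', ?_⟩
    rw [← hN (k0 + k) (Nat.le_add_right _ _)] at hn
    -- Dropping the null component moves the point into `C` without changing its value.
    have h1 := (hf (k0 + k)).add_of_eq_zero (y := (0, n)) hn (x, u')
    rw [Prod.mk_add_mk, add_zero, add_comm u'] at h1
    exact h1 ▸ hu
  have hcomp : IsCompact (S 0) := by
    refine Metric.isCompact_of_isClosed_isBounded (hclosed 0) ?_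
    obtain ⟨u0, hu0⟩ := hne 0
    have hb := (hg k0).isBounded_le C (fun u huC hu => by
      have : u ∈ N k0 ⊓ C := ⟨hu, huC⟩
      rw [hC.inf_eq_bot] at this
      exact this) (c := 2 * (c + c)) (ENNReal.mul_ne_top (by simp) (by simp [hc]))
    obtain ⟨R, hR⟩ := (Metric.isBounded_iff_subset_closedBall 0).mp hb
    -- The fibre over `x` is affine; differences of its points lie over `0`, where definiteness on
    -- `C` bounds them.
    refine (Metric.isBounded_iff_subset_closedBall u0).mpr ⟨R, fun u hu => ?_⟩
    have h1 : u - u0 ∈ {u | u ∈ C ∧ f k0 (0, u) ≤ 2 * (c + c)} := by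
      refine ⟨C.sub_mem hu.1 hu0.1, ?_⟩
      have h2 := (hf k0).sub_le (x, u) (x, u0)
      rw [Prod.mk_sub_mk, sub_self] at h2
      refine h2.trans ?_
      gcongr
      · exact hu.2
      · exact hu0.2
    have h3 := hR h1
    rw [mem_closedBall_zero_iff] at h3
    rwa [mem_closedBall_iff_norm]
  obtain ⟨u, hu⟩ := IsCompact.nonempty_iInter_of_sequence_nonempty_isCompact_isClosed S
    (fun k v hv => ⟨hv.1, (hmono (Nat.add_le_add_left (Nat.le_succ k) k0) (x, v)).trans hv.2⟩)
    hne hcomp hclosed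
  rw [Set.mem_iInter] at hu
  exact ⟨u, fun k => (hmono (Nat.le_add_left k k0) (x, u)).trans (hu k).2⟩

/-- A quadratic form with values in `[0, ∞]` has homogeneous equality constraints. -/
theorem isHomQuadForm {ι : Type} [Fintype ι] {f : (ι → ℝ) → ℝ≥0∞} (hf : IsENNQuadForm f) :
    IsHomQuadForm fun x => (f x : EReal) := by
  classical
  obtain ⟨D, B, hs, h0, h⟩ := hf.exists_bilinForm
  -- Coordinates on the quotient by `D` serve as the equality constraints; the factor 2 in the
  -- matrix below cancels the `1 / 2` of `ExtQuad.eval`.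
  let e := (Module.finBasis ℝ ((ι → ℝ) ⧸ D)).equivFun
  let L : (ι → ℝ) →ₗ[ℝ] (Fin (Module.finrank ℝ ((ι → ℝ) ⧸ D)) → ℝ) := e.toLinearMap ∘ₗ D.mkQ
  have hL : ∀ x, L x = 0 ↔ x ∈ D := by
    intro x
    simp [L]
  have hBm : ∀ x, x ⬝ᵥ (LinearMap.toMatrix₂' ℝ B).mulVec x = B x x := by
    intro x
    rw [← Matrix.toLinearMap₂'_apply', Matrix.toLinearMap₂'_toMatrix']
  refine ⟨⟨(2 : ℝ) • LinearMap.toMatrix₂' ℝ B, ?_, 0, 0, _, LinearMap.toMatrix' L, 0⟩,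
    ⟨rfl, rfl, rfl⟩, fun x => ?_⟩
  · ext i j
    simp only [Matrix.transpose_apply, Matrix.smul_apply, LinearMap.toMatrix₂'_apply, hs]
  · simp only [ExtQuad.eval, add_zero, zero_dotProduct, mul_zero, Matrix.smul_mulVec,
      dotProduct_smul, hBm, LinearMap.toMatrix'_mulVec, hL]
    rw [h]
    split_ifs
    · rw [EReal.coe_ennreal_ofReal, max_eq_left (h0 x)]
      congr 1
      simp
    · rfl

end IsENNQuadForm

namespace ExtQuad

variable {ι : Type} [Fintype ι]

/-- A convex quadratic form with homogeneous constraints is positive semidefinite on the subspace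
that the constraints define. -/
theorem dotProduct_mulVec_nonneg {f : ExtQuad ι} (hf : f.IsForm) (hc : ConvexFun f.eval)
    {x : ι → ℝ} (hx : f.F.mulVec x = 0) : 0 ≤ x ⬝ᵥ f.P.mulVec x := by
  obtain ⟨hq, hr, hg⟩ := hf
  have hev : ∀ y, f.F.mulVec y = 0 → f.eval y = ((1 / 2 * (y ⬝ᵥ f.P.mulVec y) : ℝ) : EReal) := by
    intro y hy
    simp [eval, hy, hq, hr, hg]
  -- The midpoint of `x` and `-x` is `0`, so convexity compares `f 0 = 0` with the common value at
  -- `x` and `-x`.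
  have h1 : (x, 1 / 2 * (x ⬝ᵥ f.P.mulVec x)) ∈ {p : (ι → ℝ) × ℝ | f.eval p.1 ≤ (p.2 : EReal)} :=
    (hev x hx).le
  have h2 : (-x, 1 / 2 * (x ⬝ᵥ f.P.mulVec x)) ∈ {p : (ι → ℝ) × ℝ | f.eval p.1 ≤ (p.2 : EReal)} := by
    change f.eval (-x) ≤ _
    rw [hev (-x) (by simp [Matrix.mulVec_neg, hx])]
    simp [Matrix.mulVec_neg]
  have h3 := hc h1 h2 (a := 1 / 2) (b := 1 / 2) (by norm_num) (by norm_num) (by norm_num)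
  simp only [Prod.smul_mk, Prod.mk_add_mk, smul_neg, add_neg_cancel] at h3
  have h4 : f.eval 0 ≤ ((_ : ℝ) : EReal) := h3
  rw [hev 0 (by simp), EReal.coe_le_coe_iff] at h4
  simp only [Matrix.mulVec_zero, dotProduct_zero, smul_eq_mul] at h4
  linarith

theorem eval_nonneg {f : ExtQuad ι} (hf : f.IsForm) (hc : ConvexFun f.eval) (x : ι → ℝ) :
    0 ≤ f.eval x := by
  unfold eval
  split_ifs with h
  · obtain ⟨hq, hr, hg⟩ := hf
    rw [hg, add_zero] at h
    have := dotProduct_mulVec_nonneg ⟨hq, hr, hg⟩ hc h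
    rw [hq, hr]
    norm_cast
    simp only [zero_dotProduct]
    linarith
  · exact le_top

theorem isENNQuadForm {f : ExtQuad ι} (hf : f.IsForm) (hc : ConvexFun f.eval) :
    IsENNQuadForm fun x => (f.eval x).toENNReal := by
  have hpsd := fun {x} => dotProduct_mulVec_nonneg hf hc (x := x)
  obtain ⟨hq, hr, hg⟩ := hf
  have hin : ∀ x, f.F.mulVec x = 0 →
      (f.eval x).toENNReal = ENNReal.ofReal (1 / 2 * (x ⬝ᵥ f.P.mulVec x)) := by
    intro x hx
    rw [eval, if_pos (by rw [hx, hg, add_zero]), EReal.real_coe_toENNReal, hq, hr]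
    simp only [zero_dotProduct, mul_zero, add_zero]
  have hout : ∀ x, f.F.mulVec x ≠ 0 → (f.eval x).toENNReal = ⊤ := by
    intro x hx
    simp [eval, hx, hg]
  refine ⟨fun a x => ?_, fun x y => ?_⟩
  · by_cases hx : f.F.mulVec x = 0
    · rw [hin x hx, hin (a • x) (by rw [Matrix.mulVec_smul, hx, smul_zero]),
        ← ENNReal.ofReal_mul (sq_nonneg a)]
      congr 1
      simp only [Matrix.mulVec_smul, smul_dotProduct, dotProduct_smul, smul_eq_mul]
      ring
    · rcases eq_or_ne a 0 with rfl | ha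
      · rw [zero_smul, hin 0 (by simp)]
        simp
      · rw [hout x hx, hout (a • x) (by rw [Matrix.mulVec_smul]; exact smul_ne_zero ha hx),
          ENNReal.mul_top (by simpa using ha)]
  · by_cases hx : f.F.mulVec x = 0
    · by_cases hy : f.F.mulVec y = 0
      · have h1 : f.F.mulVec (x + y) = 0 := by rw [Matrix.mulVec_add, hx, hy, add_zero]
        have h2 : f.F.mulVec (x - y) = 0 := by rw [Matrix.mulVec_sub, hx, hy, sub_zero]
        rw [hin _ h1, hin _ h2, hin _ hx, hin _ hy,
          ← ENNReal.ofReal_add (by linarith [hpsd h1]) (by linarith [hpsd h2]),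
          ← ENNReal.ofReal_add (by linarith [hpsd hx]) (by linarith [hpsd hy]),
          ← ENNReal.ofReal_ofNat, ← ENNReal.ofReal_mul (by norm_num)]
        congr 1
        simp only [Matrix.mulVec_add, Matrix.mulVec_sub, add_dotProduct, sub_dotProduct,
          dotProduct_add, dotProduct_sub]
        ring
      · rw [hout (x + y) (by rw [Matrix.mulVec_add, hx, zero_add]; exact hy), hout y hy]
        simp
    · rw [hout x hx]
      -- For infeasible `x`, the points `x + y` and `x - y` cannot both be feasible, as they sum to
      -- `2x`; both sides are then `⊤`.
      by_cases hxy : f.F.mulVec (x + y) = 0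
      · rw [hout (x - y)]
        · simp
        · intro h
          apply hx
          have h2 : f.F.mulVec (x + y) + f.F.mulVec (x - y) = (2 : ℝ) • f.F.mulVec x := by
            rw [← Matrix.mulVec_add, ← Matrix.mulVec_smul, two_smul]; congr 1; abel
          rw [hxy, h, add_zero] at h2
          exact (smul_eq_zero.mp h2.symm).resolve_left two_ne_zero
      · rw [hout (x + y) hxy]
        simp

end ExtQuad

end Topology

/-! ### The law of the Markov chain of modes. -/

section ModePaths

variable {n m K : ℕ}

/-- Summation over mode paths that start at time `T`. -/
theorem sum_modeProb_self (S : ℕ → StepData.{u} n m K) (T : ℕ) (s : Fin K)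
    (h : (Fin (T + 1) → Fin K) → ℝ≥0∞) :
    ∑ σ, ENNReal.ofReal (modeProb S T T s σ) * h σ = h fun _ => s := by
  rw [Finset.sum_eq_single (fun _ => s)]
  · have : modeProb S T T s (fun _ => s) = 1 := by
      rw [modeProb, if_pos (fun _ _ => rfl)]
      exact Finset.prod_eq_one fun τ _ => if_neg (not_le.mpr τ.2)
    rw [this, ENNReal.ofReal_one, one_mul]
  · intro σ _ hσ
    have : modeProb S T T s σ = 0 := by
      rw [modeProb, if_neg]
      intro hall
      exact hσ (funext fun τ => hall τ (Nat.lt_succ_iff.mp τ.2))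
    rw [this, ENNReal.ofReal_zero, zero_mul]
  · intro h; exact absurd (Finset.mem_univ _) h

/-- The mode path with all values up to time `t` replaced by `c`. -/
def resetPath {T : ℕ} (t : ℕ) (c : Fin K) (σ : Fin (T + 1) → Fin K) : Fin (T + 1) → Fin K :=
  fun τ => if (τ : ℕ) ≤ t then c else σ τ

/-- The first step decomposition of the law of the mode path. -/
theorem sum_modeProb_succ (S : ℕ → StepData.{u} n m K) {T t : ℕ} (ht : t < T) (s : Fin K)
    (h : (Fin (T + 1) → Fin K) → ℝ≥0∞)
    (hh : ∀ σ σ', (∀ τ : Fin (T + 1), t < (τ : ℕ) → σ τ = σ' τ) → h σ = h σ') :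
    ∑ σ, ENNReal.ofReal (modeProb S T t s σ) * h σ
      = ∑ s', ENNReal.ofReal ((S t).trans s' s)
          * ∑ σ, ENNReal.ofReal (modeProb S T (t + 1) s' σ) * h σ := by
  let p : ℕ → (Fin (T + 1) → Fin K) → ℝ := fun t σ =>
    ∏ τ : Fin T, if t ≤ (τ : ℕ) then (S τ).trans (σ τ.succ) (σ τ.castSucc) else 1
  let t1 : Fin (T + 1) := ⟨t + 1, Nat.succ_lt_succ ht⟩
  let t0 : Fin (T + 1) := ⟨t, Nat.lt_succ_of_lt ht⟩
  -- The factor of the transition at time `t` splits off; the remaining product does not involve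
  -- modes up to `t`.
  have hp : ∀ σ, p t σ = (S t).trans (σ t1) (σ t0) * p (t + 1) σ := by
    intro σ
    have e : ∀ τ : Fin T, (if t ≤ (τ : ℕ) then (S τ).trans (σ τ.succ) (σ τ.castSucc) else 1)
        = (if τ = ⟨t, ht⟩ then (S t).trans (σ t1) (σ t0) else 1)
          * (if t + 1 ≤ (τ : ℕ) then (S τ).trans (σ τ.succ) (σ τ.castSucc) else 1) := by
      intro τ
      rcases lt_trichotomy (τ : ℕ) t with hlt | heq | hgt
      · rw [if_neg (by omega), if_neg (fun h => by rw [h] at hlt; exact lt_irrefl _ hlt),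
          if_neg (by omega), one_mul]
      · have : τ = ⟨t, ht⟩ := Fin.ext heq
        subst this
        simp [t1, t0, Fin.succ, Fin.castSucc]
      · rw [if_pos (by omega), if_neg (fun h => by rw [h] at hgt; exact lt_irrefl _ hgt),
          if_pos (by omega), one_mul]
    simp only [p]
    rw [Finset.prod_congr rfl fun τ _ => e τ, Finset.prod_mul_distrib, Finset.prod_ite_eq']
    simp
  have hpcongr : ∀ σ σ', (∀ τ : Fin (T + 1), t < (τ : ℕ) → σ τ = σ' τ) →
      p (t + 1) σ = p (t + 1) σ' := by
    intro σ σ' hσ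
    refine Finset.prod_congr rfl fun τ _ => ?_
    split_ifs with hτ
    · rw [hσ τ.succ (by simp; omega), hσ τ.castSucc (by simp; omega)]
    · rfl
  have hreset : ∀ (c : Fin K) (σ : Fin (T + 1) → Fin K) (τ : Fin (T + 1)),
      t < (τ : ℕ) → resetPath t c σ τ = σ τ :=
    fun c σ τ hτ => if_neg (not_le.mpr hτ)
  have hreset' : ∀ (c : Fin K) (σ : Fin (T + 1) → Fin K) (τ : Fin (T + 1)),
      (τ : ℕ) ≤ t → resetPath t c σ τ = c :=
    fun c σ τ hτ => if_pos hτ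
  have ht1 : t < (t1 : ℕ) := Nat.lt_succ_self t
  have hL : ∀ σ, ENNReal.ofReal (modeProb S T t s σ) * h σ
      = if ∀ τ : Fin (T + 1), (τ : ℕ) ≤ t → σ τ = s then ENNReal.ofReal (p t σ) * h σ else 0 := by
    intro σ
    rw [modeProb]
    split_ifs <;> simp [p]
  have hR : ∑ s', ENNReal.ofReal ((S t).trans s' s)
          * ∑ σ, ENNReal.ofReal (modeProb S T (t + 1) s' σ) * h σ
      = ∑ σ : Fin (T + 1) → Fin K, if ∀ τ : Fin (T + 1), (τ : ℕ) ≤ t + 1 → σ τ = σ t1 then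
          ENNReal.ofReal ((S t).trans (σ t1) s) * (ENNReal.ofReal (p (t + 1) σ) * h σ) else 0 := by
    simp only [Finset.mul_sum]
    rw [Finset.sum_comm]
    refine Finset.sum_congr rfl fun σ _ => ?_
    rw [Finset.sum_eq_single (σ t1)]
    · rw [modeProb]
      split_ifs <;> simp [p]
    · intro s' _ hs'
      rw [modeProb, if_neg (fun hall => hs' (hall t1 le_rfl).symm)]
      simp
    · intro h; exact absurd (Finset.mem_univ _) h
  rw [Finset.sum_congr rfl fun σ _ => hL σ, hR, ← Finset.sum_filter, ← Finset.sum_filter]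
  -- Paths frozen at `s` up to `t` match paths constant up to `t + 1` by rewriting the prefix, which
  -- neither `h` nor the remaining product sees.
  refine Finset.sum_nbij' (fun σ => resetPath t (σ t1) σ) (fun σ => resetPath t s σ) ?_ ?_ ?_ ?_ ?_
  · intro σ _
    rw [Finset.mem_filter]
    refine ⟨Finset.mem_univ _, fun τ hτ => ?_⟩
    rw [hreset _ _ t1 ht1]
    rcases Nat.lt_or_ge t τ with hlt | hge
    · rw [hreset _ _ τ hlt]
      congr 1
      exact Fin.ext (by simp only [t1]; omega)
    · exact hreset' _ _ τ hge
  · intro σ _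
    rw [Finset.mem_filter]
    exact ⟨Finset.mem_univ _, fun τ hτ => hreset' _ _ τ hτ⟩
  · intro σ hσ
    have hσ' := (Finset.mem_filter.mp hσ).2
    funext τ
    rcases Nat.lt_or_ge t τ with hlt | hge
    · rw [hreset _ _ τ hlt, hreset _ _ τ hlt]
    · rw [hreset' _ _ τ hge, hσ' τ hge]
  · intro σ hσ
    have hσ' := (Finset.mem_filter.mp hσ).2
    funext τ
    rcases Nat.lt_or_ge t τ with hlt | hge
    · rw [hreset _ _ τ hlt, hreset _ _ τ hlt]
    · rw [hreset' _ _ τ hge, hreset _ _ t1 ht1, hσ' τ (by omega)]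
  · intro σ hσ
    have hσ' := (Finset.mem_filter.mp hσ).2
    rw [hp, hσ' t0 le_rfl, ENNReal.ofReal_mul ((S t).trans_nonneg _ _), mul_assoc,
      hreset _ _ t1 ht1, hpcongr σ _ fun τ hτ => (hreset _ _ τ hτ).symm,
      hh σ _ fun τ hτ => (hreset _ _ τ hτ).symm]

theorem sum_ofReal_trans (D : StepData.{u} n m K) (s : Fin K) :
    ∑ s', ENNReal.ofReal (D.trans s' s) = 1 := by
  rw [← ENNReal.ofReal_sum_of_nonneg fun i _ => D.trans_nonneg i s, D.trans_sum,
    ENNReal.ofReal_one]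

theorem sum_modeProb (S : ℕ → StepData.{u} n m K) {T t : ℕ} (ht : t ≤ T) (s : Fin K) :
    ∑ σ, ENNReal.ofReal (modeProb S T t s σ) = 1 := by
  induction ht using Nat.decreasingInduction generalizing s with
  | self => simpa using sum_modeProb_self S T s fun _ => 1
  | of_succ t ht ih =>
    have := sum_modeProb_succ S ht s (fun _ => 1) (fun _ _ _ => rfl)
    simp only [mul_one, ih] at this
    rw [this, sum_ofReal_trans]

end ModePaths

/-! ### Resampling one coordinate of the product law of the disturbances. -/

section Disturbances

/-- An infinite product measure is invariant under independent resampling of one coordinate. -/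
theorem infinitePi_map_update {X : ℕ → Type*} [∀ i, MeasurableSpace (X i)]
    (μ : ∀ i, Measure (X i)) [∀ i, IsProbabilityMeasure (μ i)] (t : ℕ) :
    ((μ t).prod (Measure.infinitePi μ)).map (fun p => Function.update p.2 t p.1)
      = Measure.infinitePi μ := by
  have hmeas : Measurable fun p : X t × (∀ i, X i) => Function.update p.2 t p.1 := by
    rw [measurable_pi_iff]
    intro i
    rcases eq_or_ne i t with rfl | hi
    · simpa using measurable_fst
    · simp only [Function.update_of_ne hi]
      exact (measurable_pi_apply i).comp measurable_snd
  refine Measure.eq_infinitePi μ fun s B hB => ?_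
  rw [Measure.map_apply hmeas (MeasurableSet.pi s.countable_toSet fun i _ => hB i)]
  have hpre : (fun p : X t × (∀ i, X i) => Function.update p.2 t p.1) ⁻¹' Set.pi s B
      = (if t ∈ s then B t else Set.univ) ×ˢ Set.pi (s.erase t : Finset ℕ) B := by
    ext ⟨a, w⟩
    simp only [Set.mem_preimage, Set.mem_pi, Set.mem_prod, Finset.mem_coe, Finset.mem_erase]
    constructor
    · intro h
      refine ⟨?_, fun i hi => by simpa [Function.update_of_ne hi.1] using h i hi.2⟩
      split_ifs with hts
      · simpa using h t hts
      · trivial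
    · rintro ⟨h1, h2⟩ i hi
      rcases eq_or_ne i t with rfl | hit
      · simpa [hi] using h1
      · simpa [Function.update_of_ne hit] using h2 i ⟨hit, hi⟩
  rw [hpre, Measure.prod_prod, Measure.infinitePi_pi μ fun i _ => hB i]
  split_ifs with hts
  · exact Finset.mul_prod_erase s (fun i => μ i (B i)) hts
  · rw [measure_univ, one_mul, Finset.erase_eq_of_notMem hts]

/-- This isolates the disturbance at one time as an outer integral, which is how independence enters
the Bellman recursion. -/
theorem lintegral_infinitePi_update {X : ℕ → Type*} [∀ i, MeasurableSpace (X i)]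
    (μ : ∀ i, Measure (X i)) [∀ i, IsProbabilityMeasure (μ i)] (t : ℕ) {f : (∀ i, X i) → ℝ≥0∞}
    (hf : Measurable f) :
    ∫⁻ w, f w ∂Measure.infinitePi μ
      = ∫⁻ a, ∫⁻ w, f (Function.update w t a) ∂Measure.infinitePi μ ∂μ t := by
  have hmeas : Measurable fun p : X t × (∀ i, X i) => Function.update p.2 t p.1 := by
    rw [measurable_pi_iff]
    intro i
    rcases eq_or_ne i t with rfl | hi
    · simpa using measurable_fst
    · simp only [Function.update_of_ne hi]
      exact (measurable_pi_apply i).comp measurable_snd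
  conv_lhs => rw [← infinitePi_map_update μ t]
  rw [lintegral_map hf hmeas]
  exact lintegral_prod _ (hf.comp hmeas).aemeasurable

end Disturbances

/-! ### The cost of a fixed policy and its Bellman recursion. -/

section PolicyEvaluation

variable {n m K : ℕ}

theorem StepData.measurable_next (D : StepData.{u} n m K) (s : Fin K) {Ω : Type*}
    [MeasurableSpace Ω] {x : Ω → Fin n → ℝ} {v : Ω → Fin m → ℝ} {w : Ω → D.W} (hx : Measurable x)
    (hv : Measurable v) (hw : Measurable w) :
    Measurable fun ω => D.next s (x ω) (v ω) (w ω) := by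
  rw [measurable_pi_iff]
  intro i
  simp only [StepData.next, Pi.add_apply, Matrix.mulVec, dotProduct]
  refine ((Finset.measurable_sum _ fun j _ => ?_).add
    (Finset.measurable_sum _ fun j _ => ?_)).add ((D.measurable_c s i).comp hw)
  · exact ((D.measurable_A s i j).comp hw).mul ((measurable_pi_apply j).comp hx)
  · exact ((D.measurable_B s i j).comp hw).mul ((measurable_pi_apply j).comp hv)

variable (S : ℕ → StepData.{u} n m K) (φ : ℕ → Fin K → (Fin n → ℝ) → (Fin m → ℝ))

theorem measurable_stateAt (hφ : ∀ τ s, Measurable (φ τ s)) (t : ℕ) (σ : ℕ → Fin K) (τ : ℕ) :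
    Measurable fun p : (Fin n → ℝ) × (∀ τ, (S τ).W) => stateAt S φ t p.1 p.2 σ τ := by
  induction τ with
  | zero => exact measurable_fst
  | succ τ ih =>
    simp only [stateAt]
    split_ifs
    · exact measurable_fst
    · exact (S τ).measurable_next _ ih ((hφ _ _).comp ih)
        ((measurable_pi_apply τ).comp measurable_snd)

theorem stateAt_of_le {t τ : ℕ} (h : τ ≤ t) (x : Fin n → ℝ) (w : ∀ τ, (S τ).W) (σ : ℕ → Fin K) :
    stateAt S φ t x w σ τ = x := by
  cases τ with
  | zero => rfl
  | succ τ => rw [stateAt, if_pos (Nat.lt_of_succ_le h)]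

theorem stateAt_eq_succ {t τ : ℕ} (h : t + 1 ≤ τ) (x : Fin n → ℝ) (w : ∀ τ, (S τ).W)
    (σ : ℕ → Fin K) :
    stateAt S φ t x w σ τ
      = stateAt S φ (t + 1) ((S t).next (σ t) x (φ t (σ t) x) (w t)) w σ τ := by
  induction τ, h using Nat.le_induction with
  | base =>
    rw [stateAt_of_le S φ le_rfl, stateAt, if_neg (lt_irrefl t), stateAt_of_le S φ le_rfl]
  | succ τ hτ ih =>
    rw [stateAt, if_neg (by omega), stateAt, if_neg (by omega), ih]

theorem stateAt_congr {t τ : ℕ} (x : Fin n → ℝ) {w w' : ∀ τ, (S τ).W} {σ σ' : ℕ → Fin K}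
    (hw : ∀ i, t ≤ i → w i = w' i) (hσ : ∀ i, t ≤ i → i < τ → σ i = σ' i) :
    stateAt S φ t x w σ τ = stateAt S φ t x w' σ' τ := by
  induction τ with
  | zero => rfl
  | succ τ ih =>
    rw [stateAt, stateAt]
    split_ifs with hτ
    · rfl
    · rw [ih fun i hi hi' => hσ i hi (hi'.trans (Nat.lt_succ_self τ)), hw τ (not_lt.mp hτ),
        hσ τ (not_lt.mp hτ) (Nat.lt_succ_self τ)]

variable (ℓ : ∀ τ, Fin K → (Fin n → ℝ) → (S τ).W → ℝ≥0∞) (G : Fin K → (Fin n → ℝ) → ℝ≥0∞)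

/-- The total cost along a path, for running costs `ℓ` and final costs `G`. -/
noncomputable def pathCost (T t : ℕ) (x : Fin n → ℝ) (w : ∀ τ, (S τ).W) (σ : ℕ → Fin K) : ℝ≥0∞ :=
  ∑ τ ∈ Finset.Ico t T, ℓ τ (σ τ) (stateAt S φ t x w σ τ) (w τ) + G (σ T) (stateAt S φ t x w σ T)

theorem pathCost_self (T : ℕ) (x : Fin n → ℝ) (w : ∀ τ, (S τ).W) (σ : ℕ → Fin K) :
    pathCost S φ ℓ G T T x w σ = G (σ T) x := by
  rw [pathCost, Finset.Ico_self, Finset.sum_empty, zero_add, stateAt_of_le S φ le_rfl]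

theorem pathCost_eq_succ {T t : ℕ} (ht : t < T) (x : Fin n → ℝ) (w : ∀ τ, (S τ).W)
    (σ : ℕ → Fin K) :
    pathCost S φ ℓ G T t x w σ = ℓ t (σ t) x (w t)
      + pathCost S φ ℓ G T (t + 1) ((S t).next (σ t) x (φ t (σ t) x) (w t)) w σ := by
  rw [pathCost, pathCost, Finset.sum_eq_sum_Ico_succ_bot ht, stateAt_of_le S φ le_rfl, add_assoc,
    stateAt_eq_succ S φ ht]
  congr 2
  refine Finset.sum_congr rfl fun τ hτ => ?_
  rw [stateAt_eq_succ S φ (Finset.mem_Ico.mp hτ).1]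

/-- Costs from `t` on ignore the past, so earlier disturbances can be resampled and earlier modes
reset. -/
theorem pathCost_congr {T t : ℕ} (htT : t ≤ T) (x : Fin n → ℝ) {w w' : ∀ τ, (S τ).W}
    {σ σ' : ℕ → Fin K} (hw : ∀ i, t ≤ i → w i = w' i) (hσ : ∀ i, t ≤ i → i ≤ T → σ i = σ' i) :
    pathCost S φ ℓ G T t x w σ = pathCost S φ ℓ G T t x w' σ' := by
  rw [pathCost, pathCost, hσ T htT le_rfl,
    stateAt_congr S φ x hw fun i hi hi' => hσ i hi hi'.le]
  congr 1
  refine Finset.sum_congr rfl fun τ hτ => ?_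
  obtain ⟨h1, h2⟩ := Finset.mem_Ico.mp hτ
  rw [hσ τ h1 h2.le, hw τ h1,
    stateAt_congr S φ x hw fun i hi hi' => hσ i hi (hi'.trans h2).le]

variable {S φ ℓ G}

theorem measurable_pathCost (hφ : ∀ τ s, Measurable (φ τ s))
    (hℓ : ∀ τ s, Measurable fun p : (Fin n → ℝ) × (S τ).W => ℓ τ s p.1 p.2)
    (hG : ∀ s, Measurable (G s)) (T t : ℕ) (σ : ℕ → Fin K) :
    Measurable fun p : (Fin n → ℝ) × (∀ τ, (S τ).W) => pathCost S φ ℓ G T t p.1 p.2 σ := by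
  refine (Finset.measurable_sum _ fun τ _ => ?_).add
    ((hG _).comp (measurable_stateAt S φ hφ t σ T))
  exact (hℓ τ (σ τ)).comp ((measurable_stateAt S φ hφ t σ τ).prodMk
    ((measurable_pi_apply τ).comp measurable_snd))

variable (S) in
theorem lintegral_trajLaw (T t : ℕ) (s : Fin K)
    {f : (∀ τ, (S τ).W) → (Fin (T + 1) → Fin K) → ℝ≥0∞} (hf : ∀ σ, Measurable fun w => f w σ) :
    ∫⁻ ω, f ω.1 ω.2 ∂trajLaw S T t s
      = ∑ σ, ENNReal.ofReal (modeProb S T t s σ)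
          * ∫⁻ w, f w σ ∂Measure.infinitePi fun τ => (S τ).μ := by
  have hfm : Measurable fun ω : (∀ τ, (S τ).W) × (Fin (T + 1) → Fin K) => f ω.1 ω.2 :=
    measurable_from_prod_countable_left hf
  have : SFinite (modeLaw S T t s) := by
    unfold modeLaw
    infer_instance
  rw [trajLaw, lintegral_prod_symm _ hfm.aemeasurable, modeLaw, lintegral_finsetSum_measure]
  refine Finset.sum_congr rfl fun σ _ => ?_
  rw [lintegral_smul_measure, lintegral_dirac, smul_eq_mul]

variable (S φ ℓ G) in
/-- The expected cost from time `t` on. -/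
noncomputable def policyCost (T t : ℕ) (s : Fin K) (x : Fin n → ℝ) : ℝ≥0∞ :=
  ∫⁻ ω, pathCost S φ ℓ G T t x ω.1 (extendPath ω.2) ∂trajLaw S T t s

theorem policyCost_eq_sum (hφ : ∀ τ s, Measurable (φ τ s))
    (hℓ : ∀ τ s, Measurable fun p : (Fin n → ℝ) × (S τ).W => ℓ τ s p.1 p.2)
    (hG : ∀ s, Measurable (G s)) (T t : ℕ) (s : Fin K) (x : Fin n → ℝ) :
    policyCost S φ ℓ G T t s x = ∑ σ, ENNReal.ofReal (modeProb S T t s σ)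
      * ∫⁻ w, pathCost S φ ℓ G T t x w (extendPath σ) ∂Measure.infinitePi fun τ => (S τ).μ :=
  lintegral_trajLaw S T t s (f := fun w σ => pathCost S φ ℓ G T t x w (extendPath σ)) fun σ =>
    (measurable_pathCost hφ hℓ hG T t (extendPath σ)).comp measurable_prodMk_left

theorem policyCost_self (hφ : ∀ τ s, Measurable (φ τ s))
    (hℓ : ∀ τ s, Measurable fun p : (Fin n → ℝ) × (S τ).W => ℓ τ s p.1 p.2)
    (hG : ∀ s, Measurable (G s)) (T : ℕ) (s : Fin K) (x : Fin n → ℝ) :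
    policyCost S φ ℓ G T T s x = G s x := by
  rw [policyCost_eq_sum hφ hℓ hG, sum_modeProb_self]
  simp only [pathCost_self, lintegral_const, measure_univ, mul_one]
  rfl

theorem extendPath_of_le {T τ : ℕ} (h : τ ≤ T) (σ : Fin (T + 1) → Fin K) :
    extendPath σ τ = σ ⟨τ, Nat.lt_succ_of_le h⟩ := by
  unfold extendPath
  congr 1
  exact Fin.ext (Nat.mod_eq_of_lt (Nat.lt_succ_of_le h))

/-- The expected cost of a policy satisfies the Bellman recursion of policy evaluation. -/
theorem policyCost_eq_succ (hφ : ∀ τ s, Measurable (φ τ s))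
    (hℓ : ∀ τ s, Measurable fun p : (Fin n → ℝ) × (S τ).W => ℓ τ s p.1 p.2)
    (hG : ∀ s, Measurable (G s)) {T t : ℕ} (ht : t < T) (s : Fin K) (x : Fin n → ℝ) :
    policyCost S φ ℓ G T t s x
      = ∫⁻ a, ∑ s', ENNReal.ofReal ((S t).trans s' s)
          * (ℓ t s x a + policyCost S φ ℓ G T (t + 1) s' ((S t).next s x (φ t s x) a)) ∂(S t).μ := by
  set P := Measure.infinitePi fun τ => (S τ).μ with hP
  let R : (S t).W → (ℕ → Fin K) → ℝ≥0∞ := fun a σ =>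
    ∫⁻ w, pathCost S φ ℓ G T (t + 1) ((S t).next s x (φ t s x) a) w σ ∂P
  have hnext : Measurable fun a => (S t).next s x (φ t s x) a :=
    (S t).measurable_next s measurable_const measurable_const measurable_id
  have hR : ∀ σ, Measurable fun a => R a σ := fun σ =>
    Measurable.lintegral_prod_right' (f := fun p : (S t).W × (∀ τ, (S τ).W) =>
      pathCost S φ ℓ G T (t + 1) ((S t).next s x (φ t s x) p.1) p.2 σ)
      ((measurable_pathCost hφ hℓ hG T (t + 1) σ).comp
        ((hnext.comp measurable_fst).prodMk measurable_snd))
  have hℓx : Measurable fun a => ℓ t s x a := (hℓ t s).comp measurable_prodMk_left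
  let H : (Fin (T + 1) → Fin K) → ℝ≥0∞ := fun σ => ∫⁻ a, ℓ t s x a + R a (extendPath σ) ∂(S t).μ
  -- Resampling `w t` leaves the cost from `t + 1` on unchanged except through the new state; paths
  -- with another mode at `t` have probability zero.
  have h1 : ∀ σ : Fin (T + 1) → Fin K, extendPath σ t = s →
      ∫⁻ w, pathCost S φ ℓ G T t x w (extendPath σ) ∂P = H σ := by
    intro σ hσ
    refine (lintegral_infinitePi_update (fun τ => (S τ).μ) t
      ((measurable_pathCost hφ hℓ hG T t (extendPath σ)).comp
        (measurable_prodMk_left (x := x)))).trans ?_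
    refine lintegral_congr fun a => ?_
    have e : ∀ w, pathCost S φ ℓ G T t x (Function.update w t a) (extendPath σ)
        = ℓ t s x a
          + pathCost S φ ℓ G T (t + 1) ((S t).next s x (φ t s x) a) w (extendPath σ) := by
      intro w
      rw [pathCost_eq_succ S φ ℓ G ht, hσ, Function.update_self]
      congr 1
      exact pathCost_congr S φ ℓ G ht _
        (fun i hi => Function.update_of_ne (Nat.ne_of_gt hi) _ _) fun _ _ _ => rfl
    simp only [Function.comp_apply, e]
    rw [lintegral_add_left measurable_const, lintegral_const, measure_univ, mul_one]
  have h2 : policyCost S φ ℓ G T t s x = ∑ σ, ENNReal.ofReal (modeProb S T t s σ) * H σ := by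
    rw [policyCost_eq_sum hφ hℓ hG]
    refine Finset.sum_congr rfl fun σ _ => ?_
    by_cases hσ : extendPath σ t = s
    · rw [h1 σ hσ]
    · have : modeProb S T t s σ = 0 := by
        rw [modeProb, if_neg]
        intro hall
        rw [extendPath_of_le ht.le] at hσ
        exact hσ (hall _ le_rfl)
      rw [this]; simp
  rw [h2, sum_modeProb_succ S ht s H]
  · rw [lintegral_finsetSum]
    · refine Finset.sum_congr rfl fun s' _ => ?_
      rw [lintegral_const_mul]
      · congr 1
        simp only [H]
        -- The present cost moves under the sum over paths because their probabilities add to one.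
        have e : ∀ a, ℓ t s x a + policyCost S φ ℓ G T (t + 1) s' ((S t).next s x (φ t s x) a)
            = ∑ σ, ENNReal.ofReal (modeProb S T (t + 1) s' σ)
                * (ℓ t s x a + R a (extendPath σ)) := by
          intro a
          rw [policyCost_eq_sum hφ hℓ hG]
          simp only [mul_add]
          rw [Finset.sum_add_distrib, ← Finset.sum_mul, sum_modeProb S ht, one_mul]
        simp only [e]
        rw [lintegral_finsetSum]
        · refine Finset.sum_congr rfl fun σ _ => ?_
          exact (lintegral_const_mul _ (hℓx.add (hR _))).symm
        · exact fun σ _ => (hℓx.add (hR _)).const_mul _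
      · simp only [policyCost_eq_sum hφ hℓ hG]
        exact hℓx.add (Finset.measurable_sum _ fun σ _ => (hR _).const_mul _)
    · intro s' _
      simp only [policyCost_eq_sum hφ hℓ hG]
      exact (hℓx.add (Finset.measurable_sum _ fun σ _ => (hR _).const_mul _)).const_mul _
  · intro σ σ' hσ
    refine lintegral_congr fun a => ?_
    congr 1
    refine lintegral_congr fun w => ?_
    refine pathCost_congr S φ ℓ G ht _ (fun _ _ => rfl) fun i hi hiT => ?_
    rw [extendPath_of_le hiT, extendPath_of_le hiT]
    exact hσ _ hi

end PolicyEvaluation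

/-! ### The Bellman operator on forms with values in `[0, ∞]`. -/

section DynamicProgramming

variable {n m K : ℕ}

theorem eexp_of_nonneg {Ω : Type*} [MeasurableSpace Ω] (μ : Measure Ω) {f : Ω → EReal}
    (hf : ∀ ω, 0 ≤ f ω) : eexp μ f = ((∫⁻ ω, (f ω).toENNReal ∂μ : ℝ≥0∞) : EReal) := by
  have : ∀ ω, (-f ω).toENNReal = 0 := fun ω =>
    EReal.toENNReal_of_nonpos (EReal.neg_le.mpr (by simpa using hf ω))
  simp [eexp, this]

theorem EReal.toENNReal_finset_sum {ι : Type*} (s : Finset ι) {f : ι → EReal}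
    (hf : ∀ i ∈ s, 0 ≤ f i) : (∑ i ∈ s, f i).toENNReal = ∑ i ∈ s, (f i).toENNReal := by
  classical
  induction s using Finset.induction_on with
  | empty => simp
  | insert i s hi ih =>
    rw [Finset.sum_insert hi, Finset.sum_insert hi, EReal.toENNReal_add
      (hf i (Finset.mem_insert_self i s))
      (Finset.sum_nonneg fun j hj => hf j (Finset.mem_insert_of_mem hj)),
      ih fun j hj => hf j (Finset.mem_insert_of_mem hj)]

namespace StepData

variable {D : StepData.{u} n m K}

theorem ConvexFormCost.stage_nonneg (hC : D.ConvexFormCost) (s : Fin K) (x : Fin n → ℝ)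
    (v : Fin m → ℝ) (w : D.W) : 0 ≤ D.stage s x v w :=
  ExtQuad.eval_nonneg (hC s w).1 (hC s w).2 _

variable (D) in
theorem measurable_stage (s : Fin K) {Ω : Type*} [MeasurableSpace Ω] {x : Ω → Fin n → ℝ}
    {v : Ω → Fin m → ℝ} {w : Ω → D.W} (hx : Measurable x) (hv : Measurable v)
    (hw : Measurable w) : Measurable fun ω => (D.stage s (x ω) (v ω) (w ω)).toENNReal := by
  have hz : ∀ i, Measurable fun ω => Sum.elim (x ω) (v ω) i := by
    rintro (i | i)
    · exact (measurable_pi_apply i).comp hx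
    · exact (measurable_pi_apply i).comp hv
  refine Measurable.ereal_toENNReal ?_
  unfold stage ExtQuad.eval
  refine Measurable.ite ?_ (measurable_coe_real_ereal.comp ?_) measurable_const
  · refine measurableSet_eq_fun (f := fun ω => (Matrix.fromCols (D.F s) (D.H s)).mulVec
      (Sum.elim (x ω) (v ω)) + D.h s) (g := fun _ => (0 : Fin (D.p s) → ℝ))
      (measurable_pi_iff.mpr fun i => ?_) measurable_const
    simp only [Pi.add_apply, Matrix.mulVec, dotProduct]
    exact (Finset.measurable_sum _ fun j _ => (hz j).const_mul _).add measurable_const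
  · simp only [stageQuad, Matrix.mulVec, dotProduct]
    refine Measurable.const_mul (((Finset.measurable_sum _ fun i _ => (hz i).mul
      (Finset.measurable_sum _ fun j _ => ?_)).add (Measurable.const_mul
      (Finset.measurable_sum _ fun i _ => ?_) _)).add ?_) _
    · exact ((D.measurable_P s i j).comp hw).mul (hz j)
    · exact ((D.measurable_q s i).comp hw).mul (hz i)
    · exact (D.measurable_r s).comp hw

variable (D) in
/-- The state-action function with values in `[0, ∞]`. -/
noncomputable def stateActionENN (V : Fin K → (Fin n → ℝ) → ℝ≥0∞) (s : Fin K)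
    (z : (Fin n → ℝ) × (Fin m → ℝ)) : ℝ≥0∞ :=
  ∫⁻ w, ∑ s', ENNReal.ofReal (D.trans s' s)
    * ((D.stage s z.1 z.2 w).toENNReal + V s' (D.next s z.1 z.2 w)) ∂D.μ

theorem ConvexFormCost.stateAction_eq (hC : D.ConvexFormCost)
    (V : Fin K → (Fin n → ℝ) → ℝ≥0∞) (s : Fin K) (x : Fin n → ℝ) (v : Fin m → ℝ) :
    D.stateAction (fun s' y => (V s' y : EReal)) s x v = (D.stateActionENN V s (x, v) : EReal) := by
  have h1 : ∀ (w : D.W) (s' : Fin K),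
      0 ≤ D.stage s x v w + (V s' (D.next s x v w) : EReal) := fun w s' =>
    add_nonneg (hC.stage_nonneg s x v w) (EReal.coe_ennreal_nonneg _)
  have h2 : ∀ s', (0 : EReal) ≤ (D.trans s' s : EReal) := fun s' =>
    EReal.coe_nonneg.mpr (D.trans_nonneg s' s)
  have h3 : ∀ (w : D.W) (s' : Fin K),
      0 ≤ (D.trans s' s : EReal) * (D.stage s x v w + (V s' (D.next s x v w) : EReal)) :=
    fun w s' => mul_nonneg (h2 s') (h1 w s')
  rw [stateAction, eexp_of_nonneg _ fun w => Finset.sum_nonneg fun s' _ => h3 w s']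
  congr 1
  refine lintegral_congr fun w => ?_
  rw [EReal.toENNReal_finset_sum _ fun s' _ => h3 w s']
  refine Finset.sum_congr rfl fun s' _ => ?_
  rw [EReal.toENNReal_mul (h2 s'), EReal.toENNReal_add (hC.stage_nonneg s x v w)
    (EReal.coe_ennreal_nonneg _), EReal.toENNReal_coe, EReal.real_coe_toENNReal]

theorem measurable_integrand {V : Fin K → (Fin n → ℝ) → ℝ≥0∞} (hV : ∀ s, Measurable (V s))
    (s s' : Fin K) (x : Fin n → ℝ) (v : Fin m → ℝ) :
    Measurable fun w : D.W => ENNReal.ofReal (D.trans s' s)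
      * ((D.stage s x v w).toENNReal + V s' (D.next s x v w)) :=
  ((D.measurable_stage s measurable_const measurable_const measurable_id).add ((hV s').comp
    (D.measurable_next s measurable_const measurable_const measurable_id))).const_mul _

theorem isENNQuadForm_stateActionENN (hD : D.LinearDynamics) (hC : D.ConvexFormCost)
    {V : Fin K → (Fin n → ℝ) → ℝ≥0∞} (hV : ∀ s, IsENNQuadForm (V s)) (s : Fin K) :
    IsENNQuadForm (D.stateActionENN V s) := by
  refine IsENNQuadForm.lintegral D.μ (fun w => ?_) fun z =>
    Finset.measurable_sum _ fun s' _ =>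
      measurable_integrand (fun s => (hV s).measurable) s s' z.1 z.2
  refine IsENNQuadForm.finset_sum _ fun s' => IsENNQuadForm.const_mul (IsENNQuadForm.add ?_ ?_) _
  · let L : ((Fin n → ℝ) × (Fin m → ℝ)) →ₗ[ℝ] (Fin n ⊕ Fin m → ℝ) :=
      (LinearEquiv.sumArrowLequivProdArrow (Fin n) (Fin m) ℝ ℝ).symm.toLinearMap
    exact (ExtQuad.isENNQuadForm (hC s w).1 (hC s w).2).comp L
  · let L : ((Fin n → ℝ) × (Fin m → ℝ)) →ₗ[ℝ] (Fin n → ℝ) :=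
      (D.A s w).mulVecLin.coprod (D.B s w).mulVecLin
    have hL : ∀ z : (Fin n → ℝ) × (Fin m → ℝ), D.next s z.1 z.2 w = L z := by
      intro z
      simp [next, hD s w, L]
    simp only [hL]
    exact (hV s').comp L

theorem stateActionENN_mono {V V' : Fin K → (Fin n → ℝ) → ℝ≥0∞} (h : ∀ s x, V s x ≤ V' s x)
    (s : Fin K) (z : (Fin n → ℝ) × (Fin m → ℝ)) :
    D.stateActionENN V s z ≤ D.stateActionENN V' s z := by
  refine lintegral_mono fun w => Finset.sum_le_sum fun s' _ => ?_
  gcongr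
  exact h _ _

/-- Monotone convergence, for the integral over disturbances and the finite sum over modes. -/
theorem stateActionENN_iSup {V : ℕ → Fin K → (Fin n → ℝ) → ℝ≥0∞}
    (hV : ∀ k s, Measurable (V k s)) (hmono : Monotone V) (s : Fin K)
    (z : (Fin n → ℝ) × (Fin m → ℝ)) :
    D.stateActionENN (fun s' y => ⨆ k, V k s' y) s z = ⨆ k, D.stateActionENN (V k) s z := by
  have hm : ∀ s' y, Monotone fun k => V k s' y := fun s' y i j hij => hmono hij s' y
  simp only [stateActionENN]
  rw [← lintegral_iSup]
  · refine lintegral_congr fun w => ?_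
    rw [← ENNReal.finsetSum_iSup_of_monotone]
    · refine Finset.sum_congr rfl fun s' _ => ?_
      rw [ENNReal.add_iSup, ENNReal.mul_iSup]
    · intro s' i j hij
      have := hm s' (D.next s z.1 z.2 w) hij
      dsimp only at this ⊢
      gcongr
  · exact fun k => Finset.measurable_sum _ fun s' _ => measurable_integrand (hV k) s s' z.1 z.2
  · intro i j hij w
    refine Finset.sum_le_sum fun s' _ => ?_
    have := hm s' (D.next s z.1 z.2 w) hij
    dsimp only at this ⊢
    gcongr

/-- The state-action function is minimized by a linear policy. -/
theorem exists_linear_policy (hD : D.LinearDynamics) (hC : D.ConvexFormCost)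
    {V : Fin K → (Fin n → ℝ) → ℝ≥0∞} (hV : ∀ s, IsENNQuadForm (V s)) (s : Fin K) :
    ∃ L : Matrix (Fin m) (Fin n) ℝ, ∀ x v,
      D.stateActionENN V s (x, L.mulVec x) ≤ D.stateActionENN V s (x, v) := by
  obtain ⟨L, hL⟩ := (isENNQuadForm_stateActionENN hD hC hV s).exists_linear_minimizer
  exact ⟨LinearMap.toMatrix' L, fun x v => by
    rw [LinearMap.toMatrix'_mulVec]; exact hL x v⟩

end StepData

/-! ### Finite horizon. -/

section FiniteHorizon

variable (S : ℕ → StepData.{u} n m K)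

/-- The optimal value with `k` steps to go before time `T`. -/
noncomputable def valueToGo (G : Fin K → (Fin n → ℝ) → ℝ≥0∞) (T : ℕ) :
    ℕ → Fin K → (Fin n → ℝ) → ℝ≥0∞
  | 0 => G
  | k + 1 => fun s x => ⨅ v, (S (T - (k + 1))).stateActionENN (valueToGo G T k) s (x, v)

theorem valueToGo_sub (G : Fin K → (Fin n → ℝ) → ℝ≥0∞) {T t : ℕ} (ht : t < T) :
    valueToGo S G T (T - t) = fun s x =>
      ⨅ v, (S t).stateActionENN (valueToGo S G T (T - (t + 1))) s (x, v) := by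
  have h : T - t = (T - (t + 1)) + 1 := by omega
  have h' : T - ((T - (t + 1)) + 1) = t := by omega
  rw [h, valueToGo, h']

variable {S}

theorem isENNQuadForm_valueToGo {T : ℕ}
    (hS : ∀ t < T, (S t).LinearDynamics ∧ (S t).ConvexFormCost)
    {G : Fin K → (Fin n → ℝ) → ℝ≥0∞} (hG : ∀ s, IsENNQuadForm (G s)) {t : ℕ} (ht : t ≤ T)
    (s : Fin K) : IsENNQuadForm (valueToGo S G T (T - t) s) := by
  induction ht using Nat.decreasingInduction generalizing s with
  | self => rw [Nat.sub_self]; exact hG s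
  | of_succ t ht ih =>
    rw [valueToGo_sub S G ht]
    exact (StepData.isENNQuadForm_stateActionENN (hS t ht).1 (hS t ht).2 ih s).partial_iInf

/-- The stage costs along a policy, with values in `[0, ∞]`. -/
noncomputable def policyStage (S : ℕ → StepData.{u} n m K)
    (φ : ℕ → Fin K → (Fin n → ℝ) → (Fin m → ℝ)) (τ : ℕ) (s : Fin K) (x : Fin n → ℝ)
    (w : (S τ).W) : ℝ≥0∞ :=
  ((S τ).stage s x (φ τ s x) w).toENNReal

theorem measurable_policyStage {φ : ℕ → Fin K → (Fin n → ℝ) → (Fin m → ℝ)}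
    (hφ : ∀ τ s, Measurable (φ τ s)) (τ : ℕ) (s : Fin K) :
    Measurable fun p : (Fin n → ℝ) × (S τ).W => policyStage S φ τ s p.1 p.2 :=
  (S τ).measurable_stage s measurable_fst ((hφ τ s).comp measurable_fst) measurable_snd

theorem finiteCost_eq_policyCost {T : ℕ} (hS : ∀ t < T, (S t).ConvexFormCost)
    {gT : Fin K → ExtQuad (Fin n)} (hgT : ∀ s, (gT s).IsForm ∧ ConvexFun (gT s).eval)
    (φ : ℕ → Fin K → (Fin n → ℝ) → (Fin m → ℝ)) (t : ℕ) (s : Fin K) (x : Fin n → ℝ) :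
    finiteCost S T gT φ t s x = ((policyCost S φ (policyStage S φ)
      (fun s' y => ((gT s').eval y).toENNReal) T t s x : ℝ≥0∞) : EReal) := by
  have h1 : ∀ (ω : (∀ τ, (S τ).W) × (Fin (T + 1) → Fin K)), ∀ τ ∈ Finset.Ico t T,
      0 ≤ stageAt S φ t x ω.1 (extendPath ω.2) τ := fun ω τ hτ =>
    (hS τ (Finset.mem_Ico.mp hτ).2).stage_nonneg _ _ _ _
  have h2 : ∀ s' y, 0 ≤ (gT s').eval y := fun s' y => ExtQuad.eval_nonneg (hgT s').1 (hgT s').2 y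
  rw [finiteCost, eexp_of_nonneg _ fun ω => add_nonneg (Finset.sum_nonneg (h1 ω)) (h2 _ _)]
  congr 1
  refine lintegral_congr fun ω => ?_
  rw [EReal.toENNReal_add (Finset.sum_nonneg (h1 ω)) (h2 _ _),
    EReal.toENNReal_finset_sum _ (h1 ω)]
  rfl

/-- Backward induction: the control used by `φ` is one candidate in the infimum at each step. -/
theorem valueToGo_le_policyCost {T : ℕ} {G : Fin K → (Fin n → ℝ) → ℝ≥0∞}
    (hG : ∀ s, Measurable (G s)) {φ : ℕ → Fin K → (Fin n → ℝ) → (Fin m → ℝ)}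
    (hφ : ∀ τ s, Measurable (φ τ s)) {t : ℕ} (ht : t ≤ T) (s : Fin K) (x : Fin n → ℝ) :
    valueToGo S G T (T - t) s x ≤ policyCost S φ (policyStage S φ) G T t s x := by
  induction ht using Nat.decreasingInduction generalizing s x with
  | self => rw [Nat.sub_self, policyCost_self hφ (measurable_policyStage hφ) hG]; rfl
  | of_succ t ht ih =>
    rw [valueToGo_sub S G ht, policyCost_eq_succ hφ (measurable_policyStage hφ) hG ht]
    exact (iInf_le _ (φ t s x)).trans (StepData.stateActionENN_mono ih s (x, φ t s x))

theorem policyCost_eq_valueToGo {T : ℕ} {G : Fin K → (Fin n → ℝ) → ℝ≥0∞}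
    (hG : ∀ s, Measurable (G s)) {φ : ℕ → Fin K → (Fin n → ℝ) → (Fin m → ℝ)}
    (hφ : ∀ τ s, Measurable (φ τ s))
    (hopt : ∀ t < T, ∀ s x v,
      (S t).stateActionENN (valueToGo S G T (T - (t + 1))) s (x, φ t s x)
        ≤ (S t).stateActionENN (valueToGo S G T (T - (t + 1))) s (x, v))
    {t : ℕ} (ht : t ≤ T) (s : Fin K) (x : Fin n → ℝ) :
    policyCost S φ (policyStage S φ) G T t s x = valueToGo S G T (T - t) s x := by
  induction ht using Nat.decreasingInduction generalizing s x with
  | self => rw [Nat.sub_self, policyCost_self hφ (measurable_policyStage hφ) hG]; rfl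
  | of_succ t ht ih =>
    rw [valueToGo_sub S G ht, policyCost_eq_succ hφ (measurable_policyStage hφ) hG ht]
    simp only [ih]
    exact le_antisymm (le_iInf (hopt t ht s x)) (iInf_le _ (φ t s x))

theorem measurable_mulVec (L : Matrix (Fin m) (Fin n) ℝ) :
    Measurable fun y : Fin n → ℝ => L.mulVec y :=
  (L.mulVecLin.continuous_of_finiteDimensional).measurable

theorem finiteHorizon_linear_policies (T : ℕ) (gT : Fin K → ExtQuad (Fin n))
    (hS : ∀ t < T, (S t).LinearDynamics ∧ (S t).ConvexFormCost)
    (hgT : ∀ s, (gT s).IsForm ∧ ConvexFun (gT s).eval) :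
    (∀ t ≤ T, ∀ s, IsHomQuadForm (finiteCostToGo S T gT t s)) ∧
      ∃ L : ℕ → Fin K → Matrix (Fin m) (Fin n) ℝ,
        (∀ t ≤ T, ∀ s x,
          finiteCost S T gT (fun τ s' y => (L τ s').mulVec y) t s x
            = finiteCostToGo S T gT t s x) ∧
        (∀ t < T, ∀ s x v,
          (S t).stateAction (finiteCostToGo S T gT (t + 1)) s x ((L t s).mulVec x)
            ≤ (S t).stateAction (finiteCostToGo S T gT (t + 1)) s x v) := by
  let G : Fin K → (Fin n → ℝ) → ℝ≥0∞ := fun s x => ((gT s).eval x).toENNReal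
  have hG : ∀ s, IsENNQuadForm (G s) := fun s => ExtQuad.isENNQuadForm (hgT s).1 (hgT s).2
  have hGm : ∀ s, Measurable (G s) := fun s => (hG s).measurable
  have hV : ∀ t ≤ T, ∀ s, IsENNQuadForm (valueToGo S G T (T - t) s) :=
    fun t ht s => isENNQuadForm_valueToGo hS hG ht s
  -- The condition `t < T` sits inside the existential so that one choice covers all times; later
  -- gains are zero.
  have hex : ∀ t s, ∃ L : Matrix (Fin m) (Fin n) ℝ, t < T → ∀ x v,
      (S t).stateActionENN (valueToGo S G T (T - (t + 1))) s (x, L.mulVec x)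
        ≤ (S t).stateActionENN (valueToGo S G T (T - (t + 1))) s (x, v) := by
    intro t s
    by_cases ht : t < T
    · obtain ⟨L, hL⟩ := StepData.exists_linear_policy (hS t ht).1 (hS t ht).2 (hV (t + 1) ht) s
      exact ⟨L, fun _ => hL⟩
    · exact ⟨0, fun h => absurd h ht⟩
  choose L hL using hex
  have hLm : ∀ τ s', Measurable fun y : Fin n → ℝ => (L τ s').mulVec y :=
    fun τ s' => measurable_mulVec _
  have hcost := fun φ => finiteCost_eq_policyCost (fun t ht => (hS t ht).2) hgT φ
  have hLcost : ∀ t ≤ T, ∀ s x, finiteCost S T gT (fun τ s' y => (L τ s').mulVec y) t s x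
      = (valueToGo S G T (T - t) s x : EReal) := by
    intro t ht s x
    rw [hcost, policyCost_eq_valueToGo hGm hLm (fun t ht s x v => hL t s ht x v) ht]
  have hgo : ∀ t ≤ T, ∀ s,
      finiteCostToGo S T gT t s = fun x => (valueToGo S G T (T - t) s x : EReal) := by
    intro t ht s
    funext x
    refine le_antisymm ?_ (le_iInf₂ fun φ hφ => ?_)
    · rw [← hLcost t ht s x]
      exact iInf₂_le _ hLm
    · rw [hcost, EReal.coe_ennreal_le_coe_ennreal_iff]
      exact valueToGo_le_policyCost hGm hφ ht s x
  refine ⟨fun t ht s => ?_, L, fun t ht s x => ?_, fun t ht s x v => ?_⟩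
  · rw [hgo t ht s]
    exact (hV t ht s).isHomQuadForm
  · rw [hLcost t ht, hgo t ht]
  · have e : finiteCostToGo S T gT (t + 1)
        = fun s y => (valueToGo S G T (T - (t + 1)) s y : EReal) := funext (hgo (t + 1) ht)
    rw [e, (hS t ht).2.stateAction_eq, (hS t ht).2.stateAction_eq,
      EReal.coe_ennreal_le_coe_ennreal_iff]
    exact hL t s ht x v

end FiniteHorizon

/-! ### Infinite horizon. -/

section InfiniteHorizon

variable (D : StepData.{u} n m K) (γ : ℝ)

/-- Value iteration from zero, with discount factor `γ`. -/
noncomputable def valueIter : ℕ → Fin K → (Fin n → ℝ) → ℝ≥0∞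
  | 0 => fun _ _ => 0
  | k + 1 => fun s x =>
    ⨅ v, D.stateActionENN (fun s' y => ENNReal.ofReal γ * valueIter k s' y) s (x, v)

theorem valueIter_mono : Monotone (valueIter D γ) := by
  refine monotone_nat_of_le_succ fun k => ?_
  induction k with
  | zero => exact fun s x => zero_le
  | succ k ih =>
    intro s x
    refine iInf_mono fun v => StepData.stateActionENN_mono (fun s' y => ?_) s (x, v)
    gcongr
    exact ih s' y

/-- The limit of value iteration. -/
noncomputable def valueLim (s : Fin K) (x : Fin n → ℝ) : ℝ≥0∞ :=
  ⨆ k, valueIter D γ k s x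

/-- The discounted stage costs along a time-invariant policy. -/
noncomputable def discountedStage (φ : Fin K → (Fin n → ℝ) → (Fin m → ℝ)) (τ : ℕ) (s : Fin K)
    (x : Fin n → ℝ) (w : D.W) : ℝ≥0∞ :=
  ENNReal.ofReal (γ ^ τ) * (D.stage s x (φ s x) w).toENNReal

/-- The expected discounted cost over the times `t, …, T - 1`, with values in `[0, ∞]`. -/
noncomputable def discountedPolicyCost (φ : Fin K → (Fin n → ℝ) → (Fin m → ℝ)) (T t : ℕ)
    (s : Fin K) (x : Fin n → ℝ) : ℝ≥0∞ :=
  policyCost (fun _ => D) (fun _ => φ) (discountedStage D γ φ) (fun _ _ => 0) T t s x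

variable {D γ}

/-- Stage costs at the times `0, …, N` make a problem of horizon `N + 1` with zero final cost. -/
theorem discountedCost_eq (hγ : 0 < γ) (hC : D.ConvexFormCost)
    (φ : Fin K → (Fin n → ℝ) → (Fin m → ℝ)) (s : Fin K) (x : Fin n → ℝ) (N : ℕ) :
    discountedCost D γ φ s x N = (discountedPolicyCost D γ φ (N + 1) 0 s x : EReal) := by
  have h0 : ∀ τ : ℕ, (0 : EReal) ≤ ((γ ^ τ : ℝ) : EReal) := fun τ =>
    EReal.coe_nonneg.mpr (pow_pos hγ τ).le
  have h1 : ∀ (ω : (∀ _ : ℕ, D.W) × (Fin (N + 1 + 1) → Fin K)), ∀ τ ∈ Finset.range (N + 1),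
      0 ≤ ((γ ^ τ : ℝ) : EReal)
        * stageAt (fun _ => D) (fun _ => φ) 0 x ω.1 (extendPath ω.2) τ := fun ω τ _ =>
    mul_nonneg (h0 τ) (hC.stage_nonneg _ _ _ _)
  rw [discountedCost, eexp_of_nonneg _ fun ω => Finset.sum_nonneg (h1 ω)]
  congr 1
  refine lintegral_congr fun ω => ?_
  rw [EReal.toENNReal_finset_sum _ (h1 ω), pathCost, add_zero, Finset.range_eq_Ico]
  refine Finset.sum_congr rfl fun τ _ => ?_
  rw [EReal.toENNReal_mul (h0 τ), EReal.real_coe_toENNReal]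
  rfl

theorem discountedPolicyCost_self {φ : Fin K → (Fin n → ℝ) → (Fin m → ℝ)}
    (hφ : ∀ s, Measurable (φ s)) (T : ℕ) (s : Fin K) (x : Fin n → ℝ) :
    discountedPolicyCost D γ φ T T s x = 0 :=
  policyCost_self (S := fun _ => D) (fun _ => hφ) (fun _ s =>
    (D.measurable_stage s measurable_fst ((hφ s).comp measurable_fst) measurable_snd).const_mul _)
    (fun _ => measurable_const) T s x

theorem discountedPolicyCost_succ {φ : Fin K → (Fin n → ℝ) → (Fin m → ℝ)}
    (hφ : ∀ s, Measurable (φ s)) {T t : ℕ} (ht : t < T) (s : Fin K) (x : Fin n → ℝ) :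
    discountedPolicyCost D γ φ T t s x = ∫⁻ w, ∑ s', ENNReal.ofReal (D.trans s' s)
      * (ENNReal.ofReal (γ ^ t) * (D.stage s x (φ s x) w).toENNReal
        + discountedPolicyCost D γ φ T (t + 1) s' (D.next s x (φ s x) w)) ∂D.μ :=
  policyCost_eq_succ (S := fun _ => D) (fun _ => hφ) (fun _ s =>
    (D.measurable_stage s measurable_fst ((hφ s).comp measurable_fst) measurable_snd).const_mul _)
    (fun _ => measurable_const) ht s x

/-- Absolute discounting by `γ ^ t` becomes one factor `γ` per step, so the time-invariant operator
applies at every time. -/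
theorem discounted_stateActionENN (hγ : 0 < γ) (V : Fin K → (Fin n → ℝ) → ℝ≥0∞) (t : ℕ)
    (s : Fin K) (x : Fin n → ℝ) (v : Fin m → ℝ) :
    ∫⁻ w, ∑ s', ENNReal.ofReal (D.trans s' s)
        * (ENNReal.ofReal (γ ^ t) * (D.stage s x v w).toENNReal
          + ENNReal.ofReal (γ ^ (t + 1)) * V s' (D.next s x v w)) ∂D.μ
      = ENNReal.ofReal (γ ^ t)
        * D.stateActionENN (fun s' y => ENNReal.ofReal γ * V s' y) s (x, v) := by
  rw [StepData.stateActionENN, ← lintegral_const_mul' _ _ ENNReal.ofReal_ne_top]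
  refine lintegral_congr fun w => ?_
  rw [Finset.mul_sum]
  refine Finset.sum_congr rfl fun s' _ => ?_
  rw [pow_succ, ENNReal.ofReal_mul (pow_pos hγ t).le]
  ring

theorem valueIter_le_discountedPolicyCost (hγ : 0 < γ) {φ : Fin K → (Fin n → ℝ) → (Fin m → ℝ)}
    (hφ : ∀ s, Measurable (φ s)) {T t : ℕ} (ht : t ≤ T) (s : Fin K) (x : Fin n → ℝ) :
    ENNReal.ofReal (γ ^ t) * valueIter D γ (T - t) s x
      ≤ discountedPolicyCost D γ φ T t s x := by
  induction ht using Nat.decreasingInduction generalizing s x with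
  | self => rw [Nat.sub_self, valueIter, mul_zero]; exact zero_le
  | of_succ t ht ih =>
    have h : T - t = (T - (t + 1)) + 1 := by omega
    rw [discountedPolicyCost_succ hφ ht, h, valueIter]
    refine le_trans ?_ (lintegral_mono fun w => Finset.sum_le_sum fun s' _ =>
      mul_le_mul_right (add_le_add_right (ih s' (D.next s x (φ s x) w)) _) _)
    rw [discounted_stateActionENN hγ]
    gcongr
    exact iInf_le _ _

/-- A supersolution of the policy's Bellman equation dominates its costs: backward induction starts
from the zero final cost, below any `V`. -/
theorem discountedPolicyCost_le (hγ : 0 < γ) {φ : Fin K → (Fin n → ℝ) → (Fin m → ℝ)}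
    (hφ : ∀ s, Measurable (φ s)) {V : Fin K → (Fin n → ℝ) → ℝ≥0∞}
    (hV : ∀ s x, D.stateActionENN (fun s' y => ENNReal.ofReal γ * V s' y) s (x, φ s x) ≤ V s x)
    {T t : ℕ} (ht : t ≤ T) (s : Fin K) (x : Fin n → ℝ) :
    discountedPolicyCost D γ φ T t s x ≤ ENNReal.ofReal (γ ^ t) * V s x := by
  induction ht using Nat.decreasingInduction generalizing s x with
  | self => rw [discountedPolicyCost_self hφ]; exact zero_le
  | of_succ t ht ih =>
    rw [discountedPolicyCost_succ hφ ht]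
    refine (lintegral_mono fun w => Finset.sum_le_sum fun s' _ =>
      mul_le_mul_right (add_le_add_right (ih s' (D.next s x (φ s x) w)) _) _).trans ?_
    rw [discounted_stateActionENN hγ]
    gcongr
    exact hV s x

theorem isENNQuadForm_valueIter (hD : D.LinearDynamics) (hC : D.ConvexFormCost) (k : ℕ)
    (s : Fin K) : IsENNQuadForm (valueIter D γ k s) := by
  induction k generalizing s with
  | zero => exact IsENNQuadForm.zero
  | succ k ih =>
    exact (StepData.isENNQuadForm_stateActionENN hD hC (fun s => (ih s).const_mul _) s).partial_iInf

theorem isENNQuadForm_valueLim (hD : D.LinearDynamics) (hC : D.ConvexFormCost) (s : Fin K) :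
    IsENNQuadForm (valueLim D γ s) :=
  IsENNQuadForm.iSup (fun k => isENNQuadForm_valueIter hD hC k s)
    fun _ _ hij => valueIter_mono D γ hij s

/-- A minimizer of the limiting state-action function does not exceed the limit of value
iteration. -/
theorem stateActionENN_valueLim_le (hD : D.LinearDynamics) (hC : D.ConvexFormCost) {s : Fin K}
    {x : Fin n → ℝ} {v₀ : Fin m → ℝ}
    (hv₀ : ∀ v, D.stateActionENN (fun s' y => ENNReal.ofReal γ * valueLim D γ s' y) s (x, v₀)
      ≤ D.stateActionENN (fun s' y => ENNReal.ofReal γ * valueLim D γ s' y) s (x, v)) :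
    D.stateActionENN (fun s' y => ENNReal.ofReal γ * valueLim D γ s' y) s (x, v₀)
      ≤ valueLim D γ s x := by
  let V : ℕ → Fin K → (Fin n → ℝ) → ℝ≥0∞ := fun k s' y => ENNReal.ofReal γ * valueIter D γ k s' y
  have hVq : ∀ k s, IsENNQuadForm (V k s) := fun k s =>
    (isENNQuadForm_valueIter hD hC k s).const_mul _
  have hVmono : Monotone V := by
    intro i j hij s' y
    have := valueIter_mono D γ hij s' y
    simp only [V]
    gcongr
  have hQ : ∀ v, D.stateActionENN (fun s' y => ENNReal.ofReal γ * valueLim D γ s' y) s (x, v)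
      = ⨆ k, D.stateActionENN (V k) s (x, v) := by
    intro v
    rw [← StepData.stateActionENN_iSup (fun k s => (hVq k s).measurable) hVmono]
    simp only [valueLim, V, ENNReal.mul_iSup]
  -- Interchange of infimum and supremum: each iterate attains its minimum, at most the limit value,
  -- and one control `v` does so for all iterates at once.
  obtain ⟨v, hv⟩ := IsENNQuadForm.exists_forall_le
    (f := fun k => D.stateActionENN (V k) s)
    (fun k => StepData.isENNQuadForm_stateActionENN hD hC (hVq k) s)
    (fun i j hij z => StepData.stateActionENN_mono (hVmono hij) s z) x (valueLim D γ s x) (by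
      intro k
      obtain ⟨L, hL⟩ := StepData.exists_linear_policy hD hC (hVq k) s
      exact ⟨L.mulVec x, (le_iInf (hL x)).trans
        (le_iSup (fun k => valueIter D γ k s x) (k + 1))⟩)
  refine (hv₀ v).trans ?_
  rw [hQ]
  exact iSup_le hv

theorem infiniteHorizon_linear_policies (hγ : 0 < γ) (hD : D.LinearDynamics)
    (hC : D.ConvexFormCost) :
    (∀ s, IsHomQuadForm (infiniteCostToGo D γ s)) ∧
      ∃ L : Fin K → Matrix (Fin m) (Fin n) ℝ,
        (∀ s x,
          Tendsto (discountedCost D γ (fun s' y => (L s').mulVec y) s x) atTop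
            (nhds (infiniteCostToGo D γ s x)) ∧
          infiniteCost D γ (fun s' y => (L s').mulVec y) s x = infiniteCostToGo D γ s x) ∧
        (∀ s x v,
          D.stateAction (fun s' y => (γ : EReal) * infiniteCostToGo D γ s' y) s x
              ((L s).mulVec x)
            ≤ D.stateAction (fun s' y => (γ : EReal) * infiniteCostToGo D γ s' y) s x v) := by
  have hW : ∀ s, IsENNQuadForm (valueLim D γ s) := isENNQuadForm_valueLim hD hC
  choose L hL using StepData.exists_linear_policy hD hC
    (fun s => (hW s).const_mul (ENNReal.ofReal γ))
  have hLm : ∀ s', Measurable fun y : Fin n → ℝ => (L s').mulVec y :=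
    fun s' => measurable_mulVec _
  have hlow : ∀ φ : Fin K → (Fin n → ℝ) → (Fin m → ℝ), (∀ s', Measurable (φ s')) → ∀ s x N,
      (valueIter D γ (N + 1) s x : EReal) ≤ discountedCost D γ φ s x N := by
    intro φ hφ s x N
    rw [discountedCost_eq hγ hC, EReal.coe_ennreal_le_coe_ennreal_iff]
    simpa using valueIter_le_discountedPolicyCost (D := D) hγ hφ (Nat.zero_le (N + 1)) s x
  have hup : ∀ s x N, discountedCost D γ (fun s' y => (L s').mulVec y) s x N
      ≤ (valueLim D γ s x : EReal) := by
    intro s x N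
    rw [discountedCost_eq hγ hC, EReal.coe_ennreal_le_coe_ennreal_iff]
    simpa using discountedPolicyCost_le (D := D) (V := valueLim D γ) hγ hLm
      (fun s x => stateActionENN_valueLim_le hD hC (hL s x)) (Nat.zero_le (N + 1)) s x
  have hlim : ∀ s x, Tendsto (fun N => (valueIter D γ (N + 1) s x : EReal)) atTop
      (nhds (valueLim D γ s x : EReal)) := by
    intro s x
    have h := tendsto_atTop_iSup (f := fun k => valueIter D γ k s x)
      fun i j hij => valueIter_mono D γ hij s x
    exact (continuous_coe_ennreal_ereal.tendsto _).comp (h.comp (tendsto_add_atTop_nat 1))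
  have htend : ∀ s x, Tendsto (discountedCost D γ (fun s' y => (L s').mulVec y) s x) atTop
      (nhds (valueLim D γ s x : EReal)) := fun s x =>
    tendsto_of_tendsto_of_tendsto_of_le_of_le (hlim s x) tendsto_const_nhds
      (hlow _ hLm s x) (hup s x)
  have hinf : ∀ s x, infiniteCost D γ (fun s' y => (L s').mulVec y) s x
      = (valueLim D γ s x : EReal) := fun s x => (htend s x).limsup_eq
  have hgo : ∀ s, infiniteCostToGo D γ s = fun x => (valueLim D γ s x : EReal) := by
    intro s
    funext x
    refine le_antisymm ?_ (le_iInf₂ fun φ hφ => ?_)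
    · rw [← hinf s x]
      exact iInf₂_le _ hLm
    · rw [← (hlim s x).limsup_eq]
      -- The lower bounds depend on the horizon but not on the policy, so their limit bounds every
      -- infinite-horizon cost.
      exact limsup_le_limsup (Eventually.of_forall (hlow φ hφ s x))
  refine ⟨fun s => ?_, L, fun s x => ?_, fun s x v => ?_⟩
  · rw [hgo s]
    exact (hW s).isHomQuadForm
  · rw [hgo s]
    exact ⟨htend s x, hinf s x⟩
  · have e : (fun s' y => (γ : EReal) * infiniteCostToGo D γ s' y)
        = fun s' y => ((ENNReal.ofReal γ * valueLim D γ s' y : ℝ≥0∞) : EReal) := by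
      funext s' y
      rw [hgo s', EReal.coe_ennreal_mul, EReal.coe_ennreal_ofReal, max_eq_left hγ.le]
    rw [e, hC.stateAction_eq, hC.stateAction_eq, EReal.coe_ennreal_le_coe_ennreal_iff]
    exact hL s x v

end InfiniteHorizon

end DynamicProgramming

theorem mainTheorem6 {n m K : ℕ} :
    -- finite-horizon problem
    (∀ (S : ℕ → StepData.{u} n m K) (T : ℕ) (gT : Fin K → ExtQuad (Fin n)),
      (∀ t < T, (S t).LinearDynamics ∧ (S t).ConvexFormCost) →
      (∀ s, (gT s).IsForm ∧ ConvexFun (gT s).eval) →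
      (∀ t ≤ T, ∀ s, IsHomQuadForm (finiteCostToGo S T gT t s)) ∧
      ∃ L : ℕ → Fin K → Matrix (Fin m) (Fin n) ℝ,
        (∀ t ≤ T, ∀ s x,
          finiteCost S T gT (fun τ s' y => (L τ s').mulVec y) t s x
            = finiteCostToGo S T gT t s x) ∧
        (∀ t < T, ∀ s x v,
          (S t).stateAction (finiteCostToGo S T gT (t + 1)) s x ((L t s).mulVec x)
            ≤ (S t).stateAction (finiteCostToGo S T gT (t + 1)) s x v)) ∧
    -- infinite-horizon problem
    (∀ (D : StepData.{u} n m K) (γ : ℝ), 0 < γ → γ ≤ 1 →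
      D.LinearDynamics → D.ConvexFormCost →
      (∀ s, IsHomQuadForm (infiniteCostToGo D γ s)) ∧
      ∃ L : Fin K → Matrix (Fin m) (Fin n) ℝ,
        (∀ s x,
          Tendsto (discountedCost D γ (fun s' y => (L s').mulVec y) s x) atTop
            (nhds (infiniteCostToGo D γ s x)) ∧
          infiniteCost D γ (fun s' y => (L s').mulVec y) s x = infiniteCostToGo D γ s x) ∧
        (∀ s x v,
          D.stateAction (fun s' y => (γ : EReal) * infiniteCostToGo D γ s' y) s x
              ((L s).mulVec x)
            ≤ D.stateAction (fun s' y => (γ : EReal) * infiniteCostToGo D γ s' y) s x v)) := by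
  exact ⟨fun S T gT hS hgT => finiteHorizon_linear_policies T gT hS hgT,
    fun D γ hγ _ hD hC => infiniteHorizon_linear_policies hγ hD hC⟩
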